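/- Let $\lambda$ be the uniform probability measure on $[0,1]$ and let $[0,1]^{\mathbb N}$ carry the product measure $\lambda^{\mathbb N}$; $\mathrm{Var}$, $\mathbb E$ and $\|\cdot\|_1$ refer to $\lambda^{\mathbb N}$. For $f\in L^2(\lambda^{\mathbb N})$ and $i\in\mathbb N$ put $\Delta_i f = f-\int f\,d\lambda(x_i)$, the function minus its average over the $i$-th coordinate. A function $h$ on $[0,1]^{\mathbb N}$ is called a weak partial derivative $\partial f/\partial x_i$ of $f$ if for almost every choice of the coordinates $x_j$, $j\ne i$, the one-variable functions $x_i\mapsto f(x)$ and $x_i\mapsto h(x)$ are locally integrable on $(0,1)$ and $$\int_0^1 g'(x_i)\,f(x)\,dx_i=-\int_0^1 g(x_i)\,h(x)\,dx_i$$ for every smooth function $g$ with compact support in $(0,1)$. Suppose that $f\in L^2(\lambda^{\mathbb N})$ has, for every $i\in\mathbb N$, a weak partial derivative $\frac{\partial f}{\partial x_i}\in L^2(\lambda^{\mathbb N})$. Then $$\mathrm{Var}(f)\,\log\frac{\mathrm{Var}(f)}{\sum_{i\in\mathbb N}\|\Delta_i f\|_1^2}\;\le\;\frac{2}{\pi^2}\sum_{i\in\mathbb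 N}\mathbb E\left(\left(\frac{\partial f}{\partial x_i}\right)^2\right).$$ The inequality is understood in $[-\infty,+\infty]$: the two series are sums in $[0,+\infty]$, $\log 0=-\infty$, and the left-hand side is $0$ if $\mathrm{Var}(f)=0$. -/

import Mathlib

open MeasureTheory ProbabilityTheory Set
open scoped unitInterval ENNReal ContDiff

/-- The infinite product probability measure on `[0,1]^ℕ` all of whose factors are the uniform
probability measure on `[0,1]`. -/
noncomputable def uniformProd : Measure (ℕ → I) :=
  Measure.infinitePi fun _ : ℕ => (volume : Measure I)

/-- `u'` is a weak derivative of `u` on `[0,1]`: both are locally integrable on `(0,1)` and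
`∫ g' u = - ∫ g u'` for every smooth `g : ℝ → ℝ` whose support is a compact subset of `(0,1)`. -/
def HasWeakDerivUnit (u u' : I → ℝ) : Prop :=
  LocallyIntegrableOn u (Ioo (0 : I) 1) ∧
  LocallyIntegrableOn u' (Ioo (0 : I) 1) ∧
  ∀ g : ℝ → ℝ, ContDiff ℝ ∞ g → HasCompactSupport g → tsupport g ⊆ Ioo (0 : ℝ) 1 →
    ∫ t : I, deriv g t * u t = - ∫ t : I, g t * u' t

/-- `h` is a weak partial derivative of `f` in the `i`-th coordinate: for almost every point `x`,
the function `f` with all coordinates but the `i`-th frozen at those of `x` has a weak derivative,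
given by `h` with the same coordinates frozen. (The condition does not depend on `x i`.) -/
def HasWeakPartialDeriv (i : ℕ) (f h : (ℕ → I) → ℝ) : Prop :=
  ∀ᵐ x ∂uniformProd,
    HasWeakDerivUnit (fun t => f (Function.update x i t)) (fun t => h (Function.update x i t))

/-- `Δ_i f = f - ∫ f dλ(x_i)`: the function minus its average over the `i`-th coordinate. -/
noncomputable def coordDelta (i : ℕ) (f : (ℕ → I) → ℝ) (x : ℕ → I) : ℝ :=
  f x - ∫ t : I, f (Function.update x i t)

/-! ### The Neumann heat flow on cosine polynomials -/

/-! The argument combines a sharp logarithmic Sobolev inequality on `[0,1]` with a martingale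
decomposition of `f`. One dimension: `Ent(u²) ≤ (2/π²) ∫ u'²`. For a positive cosine polynomial `F`,
run the Neumann heat flow. Along it `∫ F'²/F / (2π²) - ∫ F log F` is nonincreasing: up to an exact
derivative, its time derivative is minus a sum of squares. The constant `π²` enters as in the
Dirichlet Poincaré inequality, through the substitution `φ = sin(πx) ψ` applied to `φ = F'/√F`,
which vanishes at both endpoints. At time infinity only the mean of `F` survives, and this yields
the inequality at time zero (`entropy_cosSum_le`). Taking `F = u² + ε` and letting `ε → 0` gives the
dual form `∫ u² h ≤ (2/π²) ∫ u'²` whenever `h` is bounded and `∫ exp h ≤ 1`. In this form the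
inequality survives `L²` approximation of `u` and `u'`, hence holds for weak derivatives
(`IsTestDeriv.dual_logSobolev`). It also tensorises: `h` is bounded by a telescoping sum of
functions, each admissible in one coordinate (`dual_logSobolev_prod`). Product space: let `E_j`
denote averaging over all coordinates but the first `j`, and put `d_j = E_{j+1} f - E_j f`. A lower
bound of the entropy of `d_j²` in terms of `‖d_j‖₂` and `‖d_j‖₁` turns the logarithmic Sobolev
inequality into `‖d_j‖₂² (log θ + 1) - θ ‖d_j‖₁² ≤ (2/π²) ∑_i ‖∂_i d_j‖₂²` for each `θ > 0`
(`moment_logSobolev`). Now sum over `j` with the same `θ`. The `‖d_j‖₂²` add up to the variance.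
Moreover `‖d_j‖₁ ≤ ‖Δ_j f‖₁`, because `d_j` is an average of `Δ_j f`. For fixed `i`, the `∂_i d_j`
are orthogonal increments built from `E_j ∂_i f`, so their squared norms add up to at most `‖∂_i
f‖₂²`. The choice `θ = Var(f) / ∑ ‖Δ_i f‖₁²` finishes the proof. -/

/-- The solution at time `t` of the heat equation with initial value `∑ a k cos (k π x)`. -/
noncomputable def cosSum (n : ℕ) (a : ℕ → ℝ) (t x : ℝ) : ℝ :=
  ∑ k ∈ Finset.range n, a k * Real.exp (-(k * Real.pi) ^ 2 * t) * Real.cos (k * Real.pi * x)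

/-- The solution at time `t` of the heat equation with initial value `∑ a k sin (k π x)`. -/
noncomputable def sinSum (n : ℕ) (a : ℕ → ℝ) (t x : ℝ) : ℝ :=
  ∑ k ∈ Finset.range n, a k * Real.exp (-(k * Real.pi) ^ 2 * t) * Real.sin (k * Real.pi * x)

/-- Multiplication of the `k`-th coefficient by the frequency `k π`. -/
noncomputable def freqMul (a : ℕ → ℝ) (k : ℕ) : ℝ := k * Real.pi * a k

theorem hasDerivAt_cosSum_space (n : ℕ) (a : ℕ → ℝ) (t x : ℝ) :
    HasDerivAt (fun x => cosSum n a t x) (-sinSum n (freqMul a) t x) x := by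
  unfold cosSum sinSum freqMul
  rw [← Finset.sum_neg_distrib]
  refine HasDerivAt.fun_sum fun k _ => ?_
  have h := (((hasDerivAt_id x).const_mul (k * Real.pi)).cos).const_mul
    (a k * Real.exp (-(k * Real.pi) ^ 2 * t))
  exact h.congr_deriv (by simp; ring)

theorem hasDerivAt_sinSum_space (n : ℕ) (a : ℕ → ℝ) (t x : ℝ) :
    HasDerivAt (fun x => sinSum n a t x) (cosSum n (freqMul a) t x) x := by
  unfold cosSum sinSum freqMul
  refine HasDerivAt.fun_sum fun k _ => ?_
  have h := (((hasDerivAt_id x).const_mul (k * Real.pi)).sin).const_mul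
    (a k * Real.exp (-(k * Real.pi) ^ 2 * t))
  exact h.congr_deriv (by simp; ring)

theorem hasDerivAt_cosSum_time (n : ℕ) (a : ℕ → ℝ) (t x : ℝ) :
    HasDerivAt (fun t => cosSum n a t x) (-cosSum n (freqMul (freqMul a)) t x) t := by
  unfold cosSum freqMul
  rw [← Finset.sum_neg_distrib]
  refine HasDerivAt.fun_sum fun k _ => ?_
  have h := ((((hasDerivAt_id t).const_mul (-(k * Real.pi) ^ 2)).exp).const_mul
    (a k)).mul_const (Real.cos (k * Real.pi * x))
  exact h.congr_deriv (by simp only [id, mul_one]; ring)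

theorem hasDerivAt_sinSum_time (n : ℕ) (a : ℕ → ℝ) (t x : ℝ) :
    HasDerivAt (fun t => sinSum n a t x) (-sinSum n (freqMul (freqMul a)) t x) t := by
  unfold sinSum freqMul
  rw [← Finset.sum_neg_distrib]
  refine HasDerivAt.fun_sum fun k _ => ?_
  have h := ((((hasDerivAt_id t).const_mul (-(k * Real.pi) ^ 2)).exp).const_mul
    (a k)).mul_const (Real.sin (k * Real.pi * x))
  exact h.congr_deriv (by simp only [id, mul_one]; ring)

theorem continuous_cosSum (n : ℕ) (a : ℕ → ℝ) :
    Continuous fun z : ℝ × ℝ => cosSum n a z.1 z.2 := by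
  unfold cosSum; fun_prop

theorem continuous_sinSum (n : ℕ) (a : ℕ → ℝ) :
    Continuous fun z : ℝ × ℝ => sinSum n a z.1 z.2 := by
  unfold sinSum; fun_prop

theorem continuous_cosSum_space (n : ℕ) (a : ℕ → ℝ) (t : ℝ) :
    Continuous (cosSum n a t) := by
  unfold cosSum; fun_prop

theorem continuous_sinSum_space (n : ℕ) (a : ℕ → ℝ) (t : ℝ) :
    Continuous (sinSum n a t) := by
  unfold sinSum; fun_prop

/-- The quotient is a Chebyshev polynomial of the second kind in `cos (π x)`, built by the addition
formula. It allows the derivative of a cosine polynomial to be divided smoothly by `sin (π x)`, up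
to the endpoints. -/
theorem exists_sin_nat_mul_eq (k : ℕ) :
    ∃ D : ℝ → ℝ, ContDiff ℝ ∞ D ∧
      ∀ x, Real.sin (k * Real.pi * x) = Real.sin (Real.pi * x) * D x := by
  induction k with
  | zero => exact ⟨0, contDiff_const, by simp⟩
  | succ k ih =>
    obtain ⟨D, hD, h⟩ := ih
    refine ⟨fun x => D x * Real.cos (Real.pi * x) + Real.cos (k * Real.pi * x), by fun_prop,
      fun x => ?_⟩
    have : ((k + 1 : ℕ) : ℝ) * Real.pi * x = k * Real.pi * x + Real.pi * x := by push_cast; ring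
    rw [this, Real.sin_add, h]; ring

theorem exists_sinSum_eq (n : ℕ) (a : ℕ → ℝ) (t : ℝ) :
    ∃ R : ℝ → ℝ, ContDiff ℝ ∞ R ∧ ∀ x, sinSum n a t x = Real.sin (Real.pi * x) * R x := by
  choose D hD h using exists_sin_nat_mul_eq
  refine ⟨fun x => ∑ k ∈ Finset.range n, a k * Real.exp (-(k * Real.pi) ^ 2 * t) * D k x,
    ContDiff.sum fun k _ => contDiff_const.mul (hD k), fun x => ?_⟩
  simp only [sinSum, h, Finset.mul_sum]
  exact Finset.sum_congr rfl fun k _ => by ring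

/-- The heat flow averages the initial value against a Gaussian measure. -/
theorem cosSum_eq_integral (n : ℕ) (a : ℕ → ℝ) {t : ℝ} (ht : 0 ≤ t) (x : ℝ) :
    cosSum n a t x = ∫ y, cosSum n a 0 (x + y) ∂gaussianReal 0 (Real.toNNReal (2 * t)) := by
  -- With variance `2t` the characteristic function is `exp (-w² t)`, the damping factor of
  -- frequency `w`.
  set γ := gaussianReal 0 (Real.toNNReal (2 * t)) with hγ
  have hv : ((Real.toNNReal (2 * t) : NNReal) : ℝ) = 2 * t := Real.coe_toNNReal _ (by linarith)
  have key : ∀ w : ℝ, ∫ y, Real.cos (w * (x + y)) ∂γ = Real.exp (-w ^ 2 * t) * Real.cos (w * x) := by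
    intro w
    have h1 : charFun γ w = Real.exp (-w ^ 2 * t) := by
      rw [hγ, charFun_gaussianReal, Complex.ofReal_exp]
      congr 1
      have : (((Real.toNNReal (2 * t) : NNReal) : ℝ) : ℂ) = 2 * t := by rw [hv]; push_cast; ring
      rw [this]; push_cast; ring
    have h2 : ∫ y, Complex.exp (((w * (x + y) : ℝ) : ℂ) * Complex.I) ∂γ
        = Complex.exp ((w * x : ℝ) * Complex.I) * Real.exp (-w ^ 2 * t) := by
      rw [← h1, charFun_apply_real, ← integral_const_mul]
      refine integral_congr_ae (Filter.Eventually.of_forall fun y => ?_)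
      simp only
      rw [← Complex.exp_add]; congr 1; push_cast; ring
    have h3 := congrArg Complex.re h2
    have hint : Integrable (fun y : ℝ => Complex.exp (((w * (x + y) : ℝ) : ℂ) * Complex.I)) γ := by
      refine Integrable.of_bound (C := 1) (by fun_prop) (Filter.Eventually.of_forall fun y => ?_)
      rw [Complex.norm_exp_ofReal_mul_I]
    have h4 := integral_re (𝕜 := ℂ) hint
    simp only [RCLike.re_to_complex] at h4
    rw [← h4] at h3
    simp only [Complex.exp_ofReal_mul_I_re, Complex.re_mul_ofReal] at h3
    rw [h3]; ring
  unfold cosSum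
  rw [integral_finsetSum]
  · refine Finset.sum_congr rfl fun k _ => ?_
    rw [integral_const_mul, key]
    simp; ring
  · intro k _
    refine Integrable.const_mul (Integrable.of_bound (C := 1) (by fun_prop)
      (Filter.Eventually.of_forall fun y => ?_)) _
    exact Real.abs_cos_le_one _

/-- The minimum principle, immediate from the Gaussian averaging formula. It keeps the logarithms
and quotients along the flow under control. -/
theorem le_cosSum {n : ℕ} {a : ℕ → ℝ} {c : ℝ} (h : ∀ x, c ≤ cosSum n a 0 x) {t : ℝ}
    (ht : 0 ≤ t) (x : ℝ) : c ≤ cosSum n a t x := by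
  rw [cosSum_eq_integral n a ht]
  set γ := gaussianReal 0 (Real.toNNReal (2 * t))
  have hint : Integrable (fun y => cosSum n a 0 (x + y)) γ := by
    refine Integrable.of_bound (C := ∑ k ∈ Finset.range n, |a k|)
      (Continuous.aestronglyMeasurable ?_) (Filter.Eventually.of_forall fun y => ?_)
    · exact (continuous_cosSum_space n a 0).comp (by fun_prop)
    · unfold cosSum
      refine (norm_sum_le _ _).trans (Finset.sum_le_sum fun k _ => ?_)
      simp only [mul_zero, Real.exp_zero, mul_one, Real.norm_eq_abs, abs_mul]
      exact mul_le_of_le_one_right (abs_nonneg _) (Real.abs_cos_le_one _)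
  calc c = ∫ _, c ∂γ := by simp
    _ ≤ _ := integral_mono (integrable_const _) hint fun y => h _

theorem abs_cosSum_le (n : ℕ) (a : ℕ → ℝ) {t : ℝ} (ht : 0 ≤ t) (x : ℝ) :
    |cosSum n a t x| ≤ ∑ k ∈ Finset.range n, |a k| := by
  unfold cosSum
  refine (Finset.abs_sum_le_sum_abs _ _).trans (Finset.sum_le_sum fun k _ => ?_)
  rw [abs_mul, abs_mul, mul_assoc]
  refine mul_le_of_le_one_right (abs_nonneg _) ?_
  refine mul_le_one₀ ?_ (abs_nonneg _) (Real.abs_cos_le_one _)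
  rw [abs_of_pos (Real.exp_pos _), Real.exp_le_one_iff]
  nlinarith [sq_nonneg (k * Real.pi)]

theorem abs_sinSum_le (n : ℕ) (a : ℕ → ℝ) {t : ℝ} (ht : 0 ≤ t) (x : ℝ) :
    |sinSum n a t x| ≤ ∑ k ∈ Finset.range n, |a k| := by
  unfold sinSum
  refine (Finset.abs_sum_le_sum_abs _ _).trans (Finset.sum_le_sum fun k _ => ?_)
  rw [abs_mul, abs_mul, mul_assoc]
  refine mul_le_of_le_one_right (abs_nonneg _) ?_
  refine mul_le_one₀ ?_ (abs_nonneg _) (Real.abs_sin_le_one _)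
  rw [abs_of_pos (Real.exp_pos _), Real.exp_le_one_iff]
  nlinarith [sq_nonneg (k * Real.pi)]

theorem tendsto_exp_freq {k : ℕ} (hk : k ≠ 0) :
    Filter.Tendsto (fun t : ℝ => Real.exp (-(k * Real.pi) ^ 2 * t)) Filter.atTop (nhds 0) := by
  have : 0 < (k * Real.pi) ^ 2 := by positivity
  refine Real.tendsto_exp_atBot.comp ?_
  exact Filter.Tendsto.const_mul_atTop_of_neg (by linarith) Filter.tendsto_id

theorem tendsto_cosSum (n : ℕ) (a : ℕ → ℝ) (x : ℝ) :
    Filter.Tendsto (fun t => cosSum (n + 1) a t x) Filter.atTop (nhds (a 0)) := by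
  have : (a 0) = ∑ k ∈ Finset.range (n + 1),
      a k * (if k = 0 then 1 else 0) * Real.cos (k * Real.pi * x) := by
    rw [Finset.sum_range_succ']; simp
  rw [this]
  refine tendsto_finsetSum _ fun k _ => (Filter.Tendsto.const_mul _ ?_).mul_const _
  split_ifs with h
  · subst h; simp
  · exact tendsto_exp_freq h

theorem tendsto_sinSum (n : ℕ) (a : ℕ → ℝ) (x : ℝ) :
    Filter.Tendsto (fun t => sinSum n a t x) Filter.atTop (nhds 0) := by
  have : (0 : ℝ) = ∑ k ∈ Finset.range n,
      a k * (if k = 0 then 1 else 0) * Real.sin (k * Real.pi * x) := by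
    refine (Finset.sum_eq_zero fun k _ => ?_).symm
    split_ifs with h
    · subst h; simp
    · simp
  rw [this]
  refine tendsto_finsetSum _ fun k _ => (Filter.Tendsto.const_mul _ ?_).mul_const _
  split_ifs with h
  · subst h; simp
  · exact tendsto_exp_freq h

/-- The flow conserves the mean: every nonzero frequency integrates to zero over `[0,1]`. -/
theorem integral_cosSum (n : ℕ) (a : ℕ → ℝ) (t : ℝ) :
    ∫ x in (0 : ℝ)..1, cosSum (n + 1) a t x = a 0 := by
  unfold cosSum
  rw [intervalIntegral.integral_finsetSum
    (fun k _ => (Continuous.intervalIntegrable (by fun_prop) _ _)), Finset.sum_range_succ']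
  simp only [intervalIntegral.integral_const_mul]
  rw [Finset.sum_eq_zero]
  · simp
  · intro k _
    have hk : ((k + 1 : ℕ) : ℝ) * Real.pi ≠ 0 := by positivity
    rw [intervalIntegral.integral_comp_mul_left (fun y => Real.cos y) hk]
    simp only [integral_cos, mul_zero, Real.sin_zero, mul_one, Real.sin_nat_mul_pi]
    simp

/-! ### Entropy decay along the heat flow -/

theorem hasDerivAt_intervalIntegral_of_continuousOn {M M' : ℝ → ℝ → ℝ} {t₀ a b : ℝ}
    (hab : Icc a b ∈ nhds t₀) (hM : ∀ t ∈ Icc a b, ContinuousOn (M t) (Icc 0 1))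
    (hM' : ContinuousOn (fun z : ℝ × ℝ => M' z.1 z.2) (Icc a b ×ˢ Icc 0 1))
    (hd : ∀ t ∈ Icc a b, ∀ x ∈ Icc (0 : ℝ) 1, HasDerivAt (fun s => M s x) (M' t x) t) :
    HasDerivAt (fun t => ∫ x in (0 : ℝ)..1, M t x) (∫ x in (0 : ℝ)..1, M' t₀ x) t₀ := by
  obtain ⟨C, hC⟩ := (isCompact_Icc.prod isCompact_Icc).exists_bound_of_continuousOn hM'
  have ht₀ : t₀ ∈ Icc a b := mem_of_mem_nhds hab
  have hsub : ∀ x, x ∈ uIoc (0 : ℝ) 1 → x ∈ Icc (0 : ℝ) 1 := fun x hx => by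
    rw [uIoc_of_le zero_le_one] at hx; exact Ioc_subset_Icc_self hx
  have hint : ∀ t ∈ Icc a b, IntervalIntegrable (M t) volume 0 1 := fun t ht => by
    refine ContinuousOn.intervalIntegrable ?_
    rw [uIcc_of_le zero_le_one]; exact hM t ht
  have hint' : IntervalIntegrable (M' t₀) volume 0 1 := by
    refine ContinuousOn.intervalIntegrable ?_
    rw [uIcc_of_le zero_le_one]
    exact hM'.comp (f := fun x => (t₀, x)) (by fun_prop) fun x hx => ⟨ht₀, hx⟩
  refine (intervalIntegral.hasDerivAt_integral_of_dominated_loc_of_deriv_le (bound := fun _ => C)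
    hab ?_ (hint t₀ ht₀) ?_ ?_ (by simp) ?_).2
  · filter_upwards [hab] with t ht
    exact (intervalIntegrable_iff.1 (hint t ht)).aestronglyMeasurable
  · exact (intervalIntegrable_iff.1 hint').aestronglyMeasurable
  · exact Filter.Eventually.of_forall fun x hx t ht => hC (t, x) ⟨ht, hsub x hx⟩
  · exact Filter.Eventually.of_forall fun x hx t ht => hd t ht x (hsub x hx)

/-- The Fisher information density minus the entropy density along the heat flow. -/
noncomputable def fisherSubEntropy (n : ℕ) (a : ℕ → ℝ) (t x : ℝ) : ℝ :=
  sinSum n (freqMul a) t x ^ 2 / cosSum n a t x / (2 * Real.pi ^ 2)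
    - cosSum n a t x * Real.log (cosSum n a t x)

/-- The time derivative of `fisherSubEntropy`. -/
noncomputable def fisherSubEntropyDeriv (n : ℕ) (a : ℕ → ℝ) (t x : ℝ) : ℝ :=
  (-2 * sinSum n (freqMul a) t x * sinSum n (freqMul (freqMul (freqMul a))) t x / cosSum n a t x
    + sinSum n (freqMul a) t x ^ 2 * cosSum n (freqMul (freqMul a)) t x / cosSum n a t x ^ 2)
      / (2 * Real.pi ^ 2)
    + (Real.log (cosSum n a t x) + 1) * cosSum n (freqMul (freqMul a)) t x

theorem hasDerivAt_fisherSubEntropy (n : ℕ) (a : ℕ → ℝ) (t x : ℝ) (h : 0 < cosSum n a t x) :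
    HasDerivAt (fun t => fisherSubEntropy n a t x) (fisherSubEntropyDeriv n a t x) t := by
  have hf := hasDerivAt_cosSum_time n a t x
  have hp := hasDerivAt_sinSum_time n (freqMul a) t x
  have h1 := (((hp.pow 2).div hf h.ne').div_const (2 * Real.pi ^ 2)).sub (hf.mul (hf.log h.ne'))
  refine h1.congr_deriv ?_
  simp only [fisherSubEntropyDeriv, Pi.pow_apply]
  have hπ := Real.pi_pos.ne'
  have := h.ne'
  field_simp
  push_cast
  ring

/-- The pointwise inequality behind the decay of `fisherSubEntropy`: here `s`, `c` are the sine and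
the cosine of `π x`, `s * ρ`, `π * c * ρ + s * ρ'` and `r` are the first three derivatives of the
function with value `f`, and `l` is its logarithm. -/
theorem fisherSubEntropy_pointwise {s c ρ ρ' f r l : ℝ} (hf : 0 < f) :
    let p := s * ρ
    let q := Real.pi * c * ρ + s * ρ'
    (2 * p * r / f - p ^ 2 * q / f ^ 2) / (2 * Real.pi ^ 2) - (l + 1) * q ≤
      (2 * q ^ 2 / f + 2 * p * r / f - 2 * p ^ 2 * q / f ^ 2 - p ^ 2 * q / f ^ 2
        + 2 / 3 * p ^ 4 / f ^ 3
        - 2 * Real.pi * (Real.pi * (c ^ 2 - s ^ 2) * ρ ^ 2 / f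
          + s * c * (2 * ρ * ρ' / f - ρ ^ 2 * p / f ^ 2))) / (2 * Real.pi ^ 2)
        - (p ^ 2 / f + (l + 1) * q) := by
  intro p q
  have hπ := Real.pi_pos.ne'
  rw [← sub_nonneg]
  -- The two sides differ by exactly this quantity. Its second summand is `2 s² ((ρ/√f)')²`, the
  -- remainder in the Poincaré inequality for `p/√f = s ρ/√f`; completing that square uses `1/2` of
  -- the `2/3` in front of `p⁴/f³`, which leaves `1/6`.
  have key : 0 ≤ (p ^ 4 / (6 * f ^ 3) + 2 * s ^ 2 * (ρ' - ρ * p / (2 * f)) ^ 2 / f)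
      / (2 * Real.pi ^ 2) := by positivity
  refine key.trans_eq ?_
  simp only [p, q]
  field_simp
  ring_nf

/-- The integrand is at most an exact derivative `N'`, by the pointwise inequality. Here `N`
vanishes at `0` and `1`, since each of its terms contains `p` or `sin (π x)`. -/
theorem integral_fisherSubEntropyDeriv_nonpos (n : ℕ) (a : ℕ → ℝ) (t : ℝ)
    (h : ∀ x, 0 < cosSum n a t x) :
    ∫ x in (0 : ℝ)..1, fisherSubEntropyDeriv n a t x ≤ 0 := by
  obtain ⟨R, hR, hRs⟩ := exists_sinSum_eq n (freqMul a) t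
  set f := cosSum n a t with hfdef
  set q := fun x => -cosSum n (freqMul (freqMul a)) t x with hq
  set r := sinSum n (freqMul (freqMul (freqMul a))) t with hr
  set p := fun x => -sinSum n (freqMul a) t x with hp
  have df : ∀ x, HasDerivAt f (p x) x := hasDerivAt_cosSum_space n a t
  have dp : ∀ x, HasDerivAt p (q x) x := fun x => (hasDerivAt_sinSum_space n (freqMul a) t x).neg
  have dq : ∀ x, HasDerivAt q (r x) x := fun x =>
    (hasDerivAt_cosSum_space n (freqMul (freqMul a)) t x).neg.congr_deriv (by simp [hr])
  have ds : ∀ x, HasDerivAt (fun x => Real.sin (Real.pi * x)) (Real.pi * Real.cos (Real.pi * x)) x :=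
    fun x => (((hasDerivAt_id x).const_mul Real.pi).sin).congr_deriv (by simp; ring)
  have dc : ∀ x, HasDerivAt (fun x => Real.cos (Real.pi * x)) (-Real.pi * Real.sin (Real.pi * x)) x :=
    fun x => (((hasDerivAt_id x).const_mul Real.pi).cos).congr_deriv (by simp; ring)
  set ρ := fun x => -R x with hρ
  set ρ' := deriv ρ with hρ'
  have hρs : ContDiff ℝ ∞ ρ := hR.neg
  have dρ : ∀ x, HasDerivAt ρ (ρ' x) x := fun x =>
    ((hρs.differentiable (by simp)) x).hasDerivAt
  have pρ : ∀ x, p x = Real.sin (Real.pi * x) * ρ x := fun x => by simp [hp, hρ, hRs]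
  have qρ : ∀ x, q x = Real.pi * Real.cos (Real.pi * x) * ρ x + Real.sin (Real.pi * x) * ρ' x := by
    intro x
    have : p = fun x => Real.sin (Real.pi * x) * ρ x := funext pρ
    have h2 := (ds x).mul (dρ x)
    exact (dp x).unique (this ▸ h2)
  have cf : Continuous f := continuous_cosSum_space n a t
  have cp : Continuous p := (continuous_sinSum_space n (freqMul a) t).neg
  have cq : Continuous q := (continuous_cosSum_space n _ t).neg
  have cr : Continuous r := continuous_sinSum_space n _ t
  have cρ : Continuous ρ := hρs.continuous
  have cρ' : Continuous ρ' := hρs.continuous_deriv (by simp)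
  set N := fun x => (2 * (p x * q x) / f x - p x ^ 3 / f x ^ 2 / 3
      - 2 * Real.pi * (Real.sin (Real.pi * x) * Real.cos (Real.pi * x) * (ρ x ^ 2 / f x)))
        / (2 * Real.pi ^ 2) - (Real.log (f x) + 1) * p x with hN
  set N' := fun x => (2 * q x ^ 2 / f x + 2 * p x * r x / f x - 2 * p x ^ 2 * q x / f x ^ 2
        - p x ^ 2 * q x / f x ^ 2 + 2 / 3 * p x ^ 4 / f x ^ 3
        - 2 * Real.pi * (Real.pi * (Real.cos (Real.pi * x) ^ 2 - Real.sin (Real.pi * x) ^ 2)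
            * ρ x ^ 2 / f x + Real.sin (Real.pi * x) * Real.cos (Real.pi * x)
              * (2 * ρ x * ρ' x / f x - ρ x ^ 2 * p x / f x ^ 2))) / (2 * Real.pi ^ 2)
        - (p x ^ 2 / f x + (Real.log (f x) + 1) * q x) with hN'
  have hne : ∀ x, f x ≠ 0 := fun x => (h x).ne'
  have dN : ∀ x, HasDerivAt N (N' x) x := by
    intro x
    have h1 := (((((dp x).mul (dq x)).const_mul 2).div (df x) (hne x)).sub
      ((((dp x).pow 3).div ((df x).pow 2) (pow_ne_zero 2 (hne x))).div_const 3)).sub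
      ((((ds x).mul (dc x)).mul (((dρ x).pow 2).div (df x) (hne x))).const_mul (2 * Real.pi))
    have h2 := (h1.div_const (2 * Real.pi ^ 2)).sub ((((df x).log (hne x)).add_const 1).mul (dp x))
    refine h2.congr_deriv ?_
    simp only [hN', Pi.mul_apply, Pi.pow_apply, Pi.div_apply]
    have := hne x
    have hπ := Real.pi_pos.ne'
    field_simp
    push_cast
    ring
  have cN' : Continuous N' := by
    simp only [hN']
    fun_prop (disch := first | exact hne | exact fun x => pow_ne_zero _ (hne x) | exact fun x => by positivity)
  have hFTC : ∫ x in (0 : ℝ)..1, N' x = 0 := by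
    rw [intervalIntegral.integral_eq_sub_of_hasDerivAt (fun x _ => dN x)
      (cN'.intervalIntegrable _ _)]
    simp [hN, pρ]
  refine le_of_le_of_eq ?_ hFTC
  refine intervalIntegral.integral_mono_on zero_le_one ?_ (cN'.intervalIntegrable _ _) ?_
  · refine Continuous.intervalIntegrable ?_ _ _
    have c1 := continuous_sinSum_space n (freqMul a) t
    have c2 := continuous_cosSum_space n (freqMul (freqMul a)) t
    have e1 : Continuous fun x => sinSum n (freqMul a) t x ^ 2
        * cosSum n (freqMul (freqMul a)) t x / f x ^ 2 :=
      ((c1.pow 2).mul c2).div (cf.pow 2) fun x => pow_ne_zero 2 (hne x)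
    have e2 : Continuous fun x => -2 * sinSum n (freqMul a) t x * r x / f x :=
      ((continuous_const.mul c1).mul cr).div cf hne
    exact ((e2.add e1).div_const _).add (((cf.log hne).add continuous_const).mul c2)
  · intro x _
    have key := fisherSubEntropy_pointwise (s := Real.sin (Real.pi * x))
      (c := Real.cos (Real.pi * x)) (ρ := ρ x) (ρ' := ρ' x) (r := r x) (l := Real.log (f x)) (h x)
    simp only [← pρ, ← qρ] at key
    refine le_trans (le_of_eq ?_) key
    simp only [fisherSubEntropyDeriv, hp, hq, hr]
    ring

theorem antitoneOn_integral_fisherSubEntropy (n : ℕ) (a : ℕ → ℝ)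
    (h : ∀ t, 0 ≤ t → ∀ x, 0 < cosSum n a t x) :
    AntitoneOn (fun t => ∫ x in (0 : ℝ)..1, fisherSubEntropy n a t x) (Ici 0) := by
  have cf := continuous_cosSum n a
  have cp := continuous_sinSum n (freqMul a)
  have cq := continuous_cosSum n (freqMul (freqMul a))
  have cr := continuous_sinSum n (freqMul (freqMul (freqMul a)))
  have cM : ContinuousOn (fun z : ℝ × ℝ => fisherSubEntropy n a z.1 z.2) (Ici 0 ×ˢ univ) := by
    have hne : ∀ z ∈ Ici (0 : ℝ) ×ˢ (univ : Set ℝ), cosSum n a z.1 z.2 ≠ 0 :=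
      fun z hz => (h z.1 hz.1 z.2).ne'
    simp only [fisherSubEntropy]
    refine ContinuousOn.sub (ContinuousOn.div_const (ContinuousOn.div (by fun_prop) cf.continuousOn
      hne) _) (cf.continuousOn.mul (cf.continuousOn.log hne))
  have cM' : ContinuousOn (fun z : ℝ × ℝ => fisherSubEntropyDeriv n a z.1 z.2)
      (Ici 0 ×ˢ univ) := by
    have hne : ∀ z ∈ Ici (0 : ℝ) ×ˢ (univ : Set ℝ), cosSum n a z.1 z.2 ≠ 0 :=
      fun z hz => (h z.1 hz.1 z.2).ne'
    simp only [fisherSubEntropyDeriv]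
    refine ContinuousOn.add (ContinuousOn.div_const (ContinuousOn.add (ContinuousOn.div
      (by fun_prop) cf.continuousOn hne) (ContinuousOn.div (by fun_prop) (by fun_prop)
        fun z hz => pow_ne_zero 2 (hne z hz))) _)
      (((cf.continuousOn.log hne).add continuousOn_const).mul cq.continuousOn)
  have hderiv : ∀ t, 0 < t → HasDerivAt (fun t => ∫ x in (0 : ℝ)..1, fisherSubEntropy n a t x)
      (∫ x in (0 : ℝ)..1, fisherSubEntropyDeriv n a t x) t := by
    intro t ht
    have hsub : ∀ s ∈ Icc (t / 2) (2 * t), (0 : ℝ) ≤ s := fun s hs => by linarith [hs.1]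
    refine hasDerivAt_intervalIntegral_of_continuousOn (a := t / 2) (b := 2 * t)
      (Icc_mem_nhds (by linarith) (by linarith)) (fun s hs => ?_) ?_ ?_
    · exact cM.comp (f := fun x => (s, x)) (by fun_prop) fun x _ => ⟨hsub s hs, mem_univ _⟩
    · exact cM'.mono (prod_mono (fun s hs => hsub s hs) (subset_univ _))
    · exact fun s hs x _ => hasDerivAt_fisherSubEntropy n a s x (h s (hsub s hs) x)
  refine antitoneOn_of_deriv_nonpos (convex_Ici 0) ?_ ?_ ?_
  -- Freezing the time variable at `0` for negative times gives a globally continuous integrand,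
  -- hence continuity of the integral at the endpoint `t = 0`.
  · have c1 : Continuous fun z : ℝ × ℝ => fisherSubEntropy n a (max z.1 0) z.2 :=
      cM.comp_continuous (f := fun z : ℝ × ℝ => (max z.1 0, z.2)) (by fun_prop)
        fun z => ⟨mem_Ici.2 (le_max_right _ _), mem_univ _⟩
    have c2 := intervalIntegral.continuous_parametric_intervalIntegral_of_continuous'
      (μ := volume) (f := fun t x => fisherSubEntropy n a (max t 0) x) c1 0 1
    refine c2.continuousOn.congr fun t ht => ?_
    simp only [max_eq_left (mem_Ici.1 ht)]
  · rw [interior_Ici]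
    exact fun t ht => (hderiv t ht).differentiableAt.differentiableWithinAt
  · rw [interior_Ici]
    intro t ht
    rw [(hderiv t ht).deriv]
    exact integral_fisherSubEntropyDeriv_nonpos n a t (h t (le_of_lt ht))

/-- The logarithmic Sobolev inequality for positive cosine polynomials. -/
theorem entropy_cosSum_le (n : ℕ) (a : ℕ → ℝ) {c : ℝ} (hc : 0 < c)
    (h : ∀ x, c ≤ cosSum (n + 1) a 0 x) :
    (∫ x in (0 : ℝ)..1, cosSum (n + 1) a 0 x * Real.log (cosSum (n + 1) a 0 x))
      - a 0 * Real.log (a 0) ≤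
    1 / (2 * Real.pi ^ 2) *
      ∫ x in (0 : ℝ)..1, sinSum (n + 1) (freqMul a) 0 x ^ 2 / cosSum (n + 1) a 0 x := by
  have hpos : ∀ t, 0 ≤ t → ∀ x, c ≤ cosSum (n + 1) a t x := fun t ht => le_cosSum h ht
  have hanti := antitoneOn_integral_fisherSubEntropy (n + 1) a
    fun t ht x => hc.trans_le (hpos t ht x)
  have ha0 : 0 < a 0 := hc.trans_le (ge_of_tendsto (tendsto_cosSum n a 0)
    (Filter.eventually_atTop.2 ⟨0, fun t ht => hpos t ht 0⟩))
  have cont : ∀ t, 0 ≤ t → Continuous (fisherSubEntropy (n + 1) a t) := by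
    intro t ht
    have c1 := continuous_sinSum_space (n + 1) (freqMul a) t
    have c2 := continuous_cosSum_space (n + 1) a t
    have hne : ∀ x, cosSum (n + 1) a t x ≠ 0 := fun x => (hc.trans_le (hpos t ht x)).ne'
    unfold fisherSubEntropy
    exact (((c1.pow 2).div c2 hne).div_const _).sub (c2.mul (c2.log hne))
  -- As `t → ∞` the solution tends to its mean `a 0` and its derivative to `0`. Domination comes
  -- from the lower bound `c` and from the sums of absolute values of the coefficients.
  have hlim : Filter.Tendsto (fun t => ∫ x in (0 : ℝ)..1, fisherSubEntropy (n + 1) a t x)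
      Filter.atTop (nhds (-(a 0 * Real.log (a 0)))) := by
    have heq : -(a 0 * Real.log (a 0)) = ∫ x in (0 : ℝ)..1, -(a 0 * Real.log (a 0)) := by simp
    rw [heq]
    set B := ∑ k ∈ Finset.range (n + 1), |a k| with hB
    set D := ∑ k ∈ Finset.range (n + 1), |freqMul a k| with hD
    refine intervalIntegral.tendsto_integral_filter_of_dominated_convergence
      (fun _ => D ^ 2 / c / (2 * Real.pi ^ 2) + B * (|Real.log c| + |Real.log B|)) ?_ ?_ (by simp) ?_
    · filter_upwards [Filter.eventually_ge_atTop 0] with t ht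
      exact (cont t ht).aestronglyMeasurable
    · filter_upwards [Filter.eventually_ge_atTop 0] with t ht
      refine Filter.Eventually.of_forall fun x _ => ?_
      have h1 := hpos t ht x
      have h2 := abs_cosSum_le (n + 1) a ht x
      have h3 := abs_sinSum_le (n + 1) (freqMul a) ht x
      have hf : 0 < cosSum (n + 1) a t x := hc.trans_le h1
      have h4 : cosSum (n + 1) a t x ≤ B := (le_abs_self _).trans h2
      unfold fisherSubEntropy
      rw [Real.norm_eq_abs]
      refine (abs_sub _ _).trans (add_le_add ?_ ?_)
      · rw [abs_of_nonneg (by positivity)]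
        have : sinSum (n + 1) (freqMul a) t x ^ 2 ≤ D ^ 2 := sq_le_sq' (abs_le.1 h3).1 (abs_le.1 h3).2
        gcongr
      · rw [abs_mul]
        refine mul_le_mul h2 ?_ (abs_nonneg _) (by positivity)
        have l1 := Real.log_le_log hc h1
        have l2 := Real.log_le_log hf h4
        rw [abs_le]
        constructor
        · linarith [neg_abs_le (Real.log c), abs_nonneg (Real.log B)]
        · linarith [le_abs_self (Real.log B), abs_nonneg (Real.log c)]
    · refine Filter.Eventually.of_forall fun x _ => ?_
      have t1 := tendsto_cosSum n a x
      have t2 := tendsto_sinSum (n + 1) (freqMul a) x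
      have t3 := (((t2.pow 2).div t1 ha0.ne').div_const (2 * Real.pi ^ 2)).sub
        (t1.mul (t1.log ha0.ne'))
      simpa [fisherSubEntropy] using t3
  have hle : -(a 0 * Real.log (a 0)) ≤ ∫ x in (0 : ℝ)..1, fisherSubEntropy (n + 1) a 0 x :=
    le_of_tendsto hlim (Filter.eventually_atTop.2
      ⟨0, fun t ht => hanti (mem_Ici.2 le_rfl) (mem_Ici.2 ht) ht⟩)
  have c1 := continuous_sinSum_space (n + 1) (freqMul a) 0
  have c2 := continuous_cosSum_space (n + 1) a 0
  have hne : ∀ x, cosSum (n + 1) a 0 x ≠ 0 := fun x => (hc.trans_le (h x)).ne'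
  have hsplit : ∫ x in (0 : ℝ)..1, fisherSubEntropy (n + 1) a 0 x =
      1 / (2 * Real.pi ^ 2) *
        (∫ x in (0 : ℝ)..1, sinSum (n + 1) (freqMul a) 0 x ^ 2 / cosSum (n + 1) a 0 x)
      - ∫ x in (0 : ℝ)..1, cosSum (n + 1) a 0 x * Real.log (cosSum (n + 1) a 0 x) := by
    unfold fisherSubEntropy
    rw [intervalIntegral.integral_sub, intervalIntegral.integral_div]
    · ring
    · exact (((c1.pow 2).div c2 hne).div_const _).intervalIntegrable _ _
    · exact (c2.mul (c2.log hne)).intervalIntegrable _ _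
  linarith

/-! ### The dual logarithmic Sobolev inequality for cosine polynomials -/

theorem exists_cosSum_of_mem_span {F : ℝ → ℝ}
    (hF : F ∈ Submodule.span ℝ (range fun (k : ℕ) (x : ℝ) => Real.cos (k * Real.pi * x))) :
    ∃ (n : ℕ) (a : ℕ → ℝ), ∀ x, F x = cosSum (n + 1) a 0 x := by
  obtain ⟨c, rfl⟩ := Finsupp.mem_span_range_iff_exists_finsupp.1 hF
  refine ⟨c.support.sup id, c, fun x => ?_⟩
  have hsub : c.support ⊆ Finset.range (c.support.sup id + 1) := fun k hk =>
    Finset.mem_range.2 (Nat.lt_succ_of_le (Finset.le_sup (f := id) hk))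
  simp only [cosSum, mul_zero, Real.exp_zero, mul_one]
  rw [Finsupp.sum, Finset.sum_apply, Finset.sum_subset hsub]
  · simp
  · intro k _ hk
    simp [Finsupp.notMem_support_iff.1 hk]

theorem cos_mul_mem_span {F : ℝ → ℝ}
    (hF : F ∈ Submodule.span ℝ (range fun (k : ℕ) (x : ℝ) => Real.cos (k * Real.pi * x))) :
    (fun x => Real.cos (Real.pi * x) * F x) ∈
      Submodule.span ℝ (range fun (k : ℕ) (x : ℝ) => Real.cos (k * Real.pi * x)) := by
  induction hF using Submodule.span_induction with
  | zero =>
    convert Submodule.zero_mem (Submodule.span ℝ _) using 1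
    ext x; simp
  | add F G _ _ hF hG =>
    convert Submodule.add_mem _ hF hG using 1
    ext x; simp [mul_add]
  | smul c F _ hF =>
    convert Submodule.smul_mem _ c hF using 1
    ext x; simp; ring
  | mem F hF =>
    obtain ⟨k, rfl⟩ := hF
    have hk : ∀ k : ℕ, (fun x : ℝ => Real.cos (k * Real.pi * x)) ∈ Submodule.span ℝ
        (range fun (k : ℕ) (x : ℝ) => Real.cos (k * Real.pi * x)) :=
      fun k => Submodule.subset_span ⟨k, rfl⟩
    cases k with
    | zero => simpa using hk 1
    | succ k =>
      convert Submodule.smul_mem _ (1 / 2 : ℝ) (Submodule.add_mem _ (hk (k + 2)) (hk k)) using 1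
      ext x
      simp only [Pi.smul_apply, Pi.add_apply, smul_eq_mul]
      have e1 : ((k + 2 : ℕ) : ℝ) * Real.pi * x
        = ((k + 1 : ℕ) : ℝ) * Real.pi * x + Real.pi * x := by push_cast; ring
      have e2 : (k : ℝ) * Real.pi * x
        = ((k + 1 : ℕ) : ℝ) * Real.pi * x - Real.pi * x := by push_cast; ring
      rw [e1, e2, Real.cos_add, Real.cos_sub]; ring

/-- Polynomials in `cos (π x)` are closed under squaring and adding constants. This makes `u² + ε`
an admissible initial value for the heat flow. -/
theorem exists_cosSum_eq_eval (P : Polynomial ℝ) :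
    ∃ (n : ℕ) (a : ℕ → ℝ), ∀ x, P.eval (Real.cos (Real.pi * x)) = cosSum (n + 1) a 0 x := by
  refine exists_cosSum_of_mem_span (F := fun x => P.eval (Real.cos (Real.pi * x))) ?_
  induction P using Polynomial.induction_on with
  | C c =>
    have h0 : (fun x : ℝ => Real.cos ((0 : ℕ) * Real.pi * x)) ∈ Submodule.span ℝ
        (range fun (k : ℕ) (x : ℝ) => Real.cos (k * Real.pi * x)) :=
      Submodule.subset_span ⟨0, rfl⟩
    convert Submodule.smul_mem _ c h0 using 1
    ext x; simp
  | add P Q hP hQ =>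
    convert Submodule.add_mem _ hP hQ using 1
    ext x; simp
  | monomial k c h =>
    convert cos_mul_mem_span h using 1
    ext x; simp; ring

theorem integral_unitInterval_eq (F : ℝ → ℝ) : ∫ t : I, F t = ∫ x in (0 : ℝ)..1, F x := by
  rw [intervalIntegral.integral_of_le zero_le_one, ← integral_Icc_eq_integral_Ioc]
  exact integral_subtype measurableSet_Icc F

theorem Continuous.integrable_unitInterval {F : I → ℝ} (hF : Continuous F) : Integrable F := by
  rw [← integrableOn_univ]
  exact hF.continuousOn.integrableOn_compact isCompact_univ

/-- Fenchel duality between `x log x` and `exp`. Integrated with `m = ∫ f` and `∫ exp h ≤ 1`, it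
bounds `∫ f h` by the entropy of `f`. -/
theorem young_entropy {f m h : ℝ} (hf : 0 < f) (hm : 0 < m) :
    f * h ≤ f * Real.log f - f * Real.log m - f + m * Real.exp h := by
  have h1 := Real.add_one_le_exp (h + Real.log m - Real.log f)
  have h2 : Real.exp (h + Real.log m - Real.log f) = m * Real.exp h / f := by
    rw [Real.exp_sub, Real.exp_add, Real.exp_log hf, Real.exp_log hm]; ring
  rw [h2, le_div_iff₀ hf] at h1
  linarith

/-- The dual logarithmic Sobolev inequality for polynomials in `cos (π x)`. -/
theorem dual_logSobolev_eval_cos (P : Polynomial ℝ) {h : I → ℝ} (hm : Measurable h) {C : ℝ}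
    (hb : ∀ t, |h t| ≤ C) (hexp : ∫ t, Real.exp (h t) ≤ 1) :
    ∫ t : I, P.eval (Real.cos (Real.pi * t)) ^ 2 * h t ≤ 2 / Real.pi ^ 2 *
      ∫ t : I, (P.derivative.eval (Real.cos (Real.pi * t)) *
        (-Real.pi * Real.sin (Real.pi * t))) ^ 2 := by
  set u : ℝ → ℝ := fun x => P.eval (Real.cos (Real.pi * x)) with hu
  set u' : ℝ → ℝ := fun x => P.derivative.eval (Real.cos (Real.pi * x)) *
        (-Real.pi * Real.sin (Real.pi * x)) with hu'
  have hC : 0 ≤ C := (abs_nonneg _).trans (hb 0)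
  have du : ∀ x, HasDerivAt u (u' x) x := fun x => by
    have h1 := (((hasDerivAt_id x).const_mul Real.pi).cos)
    have h2 := (P.hasDerivAt (Real.cos (Real.pi * x))).comp x h1
    exact h2.congr_deriv (by simp only [hu', id]; ring)
  have cu : Continuous u := by simp only [hu]; fun_prop
  have cu' : Continuous u' := by simp only [hu']; fun_prop
  have hhi : Integrable h := Integrable.of_bound hm.aestronglyMeasurable C
    (Filter.Eventually.of_forall hb)
  have hei : Integrable fun t => Real.exp (h t) :=
    Integrable.of_bound hm.exp.aestronglyMeasurable (Real.exp C)
      (Filter.Eventually.of_forall fun t => by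
        rw [Real.norm_eq_abs, Real.abs_exp]
        exact Real.exp_le_exp.2 ((le_abs_self _).trans (hb t)))
  have mulh : ∀ {F : I → ℝ}, Integrable F → Integrable fun t => F t * h t := fun hF =>
    hF.mul_bdd (c := C) hm.aestronglyMeasurable (Filter.Eventually.of_forall hb)
  -- Adding `ε` makes `u²` strictly positive, so the entropy inequality applies; the Fisher
  -- information is then `∫ (2uu')²/(u² + ε) ≤ 4 ∫ u'²`, whence the constant `4/(2π²) = 2/π²`.
  have key : ∀ ε : ℝ, 0 < ε → ∫ t : I, (u t ^ 2 + ε) * h t ≤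
      2 / Real.pi ^ 2 * ∫ t : I, u' t ^ 2 := by
    intro ε hε
    obtain ⟨n, a, ha⟩ := exists_cosSum_eq_eval (P ^ 2 + Polynomial.C ε)
    have hfa : ∀ x, u x ^ 2 + ε = cosSum (n + 1) a 0 x := fun x => by rw [← ha x]; simp [hu]
    have hda : ∀ x, sinSum (n + 1) (freqMul a) 0 x = -(2 * u x * u' x) := fun x => by
      have e : (fun x => u x ^ 2 + ε) = cosSum (n + 1) a 0 := funext hfa
      have d1 := ((du x).pow 2).add_const ε
      have d2 := hasDerivAt_cosSum_space (n + 1) a 0 x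
      have d3 := d1.unique (e ▸ d2)
      simp only [Nat.cast_ofNat, Nat.add_one_sub_one, pow_one] at d3
      linarith
    have hfpos : ∀ x, 0 < u x ^ 2 + ε := fun x => by positivity
    have hent := entropy_cosSum_le n a hε fun x => by
      rw [← hfa]; nlinarith [sq_nonneg (u x)]
    have hmean : ∫ x in (0 : ℝ)..1, (u x ^ 2 + ε) = a 0 := by
      rw [← integral_cosSum n a 0]; simp only [hfa]
    simp only [← hfa, hda] at hent
    have ha0 : 0 < a 0 := by
      rw [← hmean]
      exact intervalIntegral.intervalIntegral_pos_of_pos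
        (((cu.pow 2).add continuous_const).intervalIntegrable _ _) hfpos zero_lt_one
    have hF : (∫ x in (0 : ℝ)..1, (-(2 * u x * u' x)) ^ 2 / (u x ^ 2 + ε)) ≤
        ∫ x in (0 : ℝ)..1, 4 * u' x ^ 2 := by
      refine intervalIntegral.integral_mono_on zero_le_one
        (Continuous.intervalIntegrable ?_ _ _) (Continuous.intervalIntegrable (by fun_prop) _ _)
        fun x _ => ?_
      · exact Continuous.div (by fun_prop) (by fun_prop) fun x => (hfpos x).ne'
      · rw [div_le_iff₀ (hfpos x)]
        nlinarith [mul_nonneg hε.le (sq_nonneg (u' x))]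
    rw [intervalIntegral.integral_const_mul, ← integral_unitInterval_eq (fun x => u' x ^ 2)] at hF
    rw [← integral_unitInterval_eq (fun x => (u x ^ 2 + ε) * Real.log (u x ^ 2 + ε))] at hent
    rw [← integral_unitInterval_eq (fun x => u x ^ 2 + ε)] at hmean
    have cf : Continuous fun t : I => u t ^ 2 + ε := by fun_prop
    have cfl : Continuous fun t : I => (u t ^ 2 + ε) * Real.log (u t ^ 2 + ε) :=
      cf.mul (cf.log fun t => (hfpos t).ne')
    have i1 := cf.integrable_unitInterval
    have i2 := cfl.integrable_unitInterval
    have hint : ∫ t : I, (u t ^ 2 + ε) * h t ≤ ∫ t : I, ((u t ^ 2 + ε) * Real.log (u t ^ 2 + ε)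
        - (u t ^ 2 + ε) * Real.log (a 0) - (u t ^ 2 + ε) + a 0 * Real.exp (h t)) :=
      integral_mono (mulh i1) (((i2.sub (i1.mul_const _)).sub i1).add (hei.const_mul _))
        fun t => young_entropy (hfpos t) ha0
    have i3 : Integrable fun t : I => (u t ^ 2 + ε) * Real.log (u t ^ 2 + ε)
        - (u t ^ 2 + ε) * Real.log (a 0) := i2.sub (i1.mul_const _)
    have i4 : Integrable fun t : I => (u t ^ 2 + ε) * Real.log (u t ^ 2 + ε)
        - (u t ^ 2 + ε) * Real.log (a 0) - (u t ^ 2 + ε) := i3.sub i1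
    rw [integral_add i4 (hei.const_mul _), integral_sub i3 i1, integral_sub i2 (i1.mul_const _),
      integral_mul_const, integral_const_mul, hmean] at hint
    have h3 : a 0 * ∫ t : I, Real.exp (h t) ≤ a 0 := mul_le_of_le_one_right ha0.le hexp
    have h4 : 1 / (2 * Real.pi ^ 2) *
        (∫ x in (0 : ℝ)..1, (-(2 * u x * u' x)) ^ 2 / (u x ^ 2 + ε)) ≤
        1 / (2 * Real.pi ^ 2) * (4 * ∫ t : I, u' t ^ 2) :=
      mul_le_mul_of_nonneg_left hF (by positivity)
    have h5 : 1 / (2 * Real.pi ^ 2) * (4 * ∫ t : I, u' t ^ 2)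
        = 2 / Real.pi ^ 2 * ∫ t : I, u' t ^ 2 := by
      have := Real.pi_pos.ne'
      field_simp; norm_num
    linarith
  have hhC : -C ≤ ∫ t, h t := by
    have := norm_integral_le_of_norm_le_const (μ := (volume : Measure I))
      (f := h) (Filter.Eventually.of_forall hb)
    simp only [probReal_univ, mul_one, Real.norm_eq_abs] at this
    exact (abs_le.1 this).1
  refine le_of_forall_pos_le_add fun δ hδ => ?_
  have hε : 0 < δ / (C + 1) := by positivity
  have h1 := key _ hε
  have i1 : Integrable fun t : I => u t ^ 2 :=
    Continuous.integrable_unitInterval (by fun_prop)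
  simp only [add_mul] at h1
  rw [integral_add (mulh i1) (hhi.const_mul _), integral_const_mul] at h1
  have h2 : δ / (C + 1) * C ≤ δ := by
    rw [div_mul_eq_mul_div, div_le_iff₀ (by positivity)]; nlinarith
  have h3 : δ / (C + 1) * (-C) ≤ δ / (C + 1) * ∫ t, h t := mul_le_mul_of_nonneg_left hhC hε.le
  linarith

/-! ### Weak derivatives on the unit interval -/

/-- Integration by parts against test functions: `∫ g' u = - ∫ g u'` for every smooth `g` with
compact support in `(0,1)`. -/
def IsTestDeriv (u u' : I → ℝ) : Prop :=
  ∀ g : ℝ → ℝ, ContDiff ℝ ∞ g → HasCompactSupport g → tsupport g ⊆ Ioo (0 : ℝ) 1 →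
    ∫ t : I, deriv g t * u t = - ∫ t : I, g t * u' t

theorem integral_unitInterval_eq_integral {F : ℝ → ℝ} (hF : ∀ x, x ∉ Ioo (0 : ℝ) 1 → F x = 0) :
    ∫ t : I, F t = ∫ x, F x := by
  rw [← setIntegral_eq_integral_of_forall_compl_eq_zero (s := Icc (0 : ℝ) 1) (μ := volume)]
  · exact integral_subtype measurableSet_Icc F
  · exact fun x hx => hF x fun h => hx (Ioo_subset_Icc_self h)

/-- A smooth function of vanishing integral with compact support in `(0,1)` has a primitive with
the same properties. -/
theorem exists_primitive_test {ψ : ℝ → ℝ} (h : ContDiff ℝ ∞ ψ) (hc : HasCompactSupport ψ)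
    (hs : tsupport ψ ⊆ Ioo (0 : ℝ) 1) (h0 : ∫ x, ψ x = 0) :
    ∃ g : ℝ → ℝ, ContDiff ℝ ∞ g ∧ HasCompactSupport g ∧ tsupport g ⊆ Ioo (0 : ℝ) 1 ∧
      deriv g = ψ := by
  rcases (tsupport ψ).eq_empty_or_nonempty with he | hne
  · have : ψ = 0 := tsupport_eq_empty_iff.1 he
    subst this
    exact ⟨0, contDiff_const, HasCompactSupport.zero, by simp, by simp⟩
  have hd : ∀ x, HasDerivAt (fun x => ∫ y in (0 : ℝ)..x, ψ y) (ψ x) x := fun x =>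
    intervalIntegral.integral_hasDerivAt_right (h.continuous.intervalIntegrable _ _)
      h.continuous.aestronglyMeasurable.stronglyMeasurableAtFilter h.continuous.continuousAt
  obtain ⟨a, ha, hamin⟩ := hc.isCompact.exists_isLeast hne
  obtain ⟨b, hb, hbmax⟩ := hc.isCompact.exists_isGreatest hne
  -- Left of the support of `ψ` the primitive has not started to grow; right of it, it equals the
  -- total integral, which is zero.
  have hsub : tsupport (fun x => ∫ y in (0 : ℝ)..x, ψ y) ⊆ Icc a b := by
    refine closure_minimal (fun x hx => ?_) isClosed_Icc
    by_contra hxab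
    refine hx ?_
    have hzero : ∀ y, y ∉ Icc a b → ψ y = 0 := fun y hy => by
      by_contra hne
      exact hy ⟨hamin (subset_tsupport _ hne), hbmax (subset_tsupport _ hne)⟩
    rcases lt_or_ge x a with hxa | hxa
    · refine (intervalIntegral.integral_congr (g := fun _ => 0) fun y hy => hzero y fun hy2 => ?_).trans
        (by simp)
      have h1 := hy.2
      have h2 := (hs ha).1
      exact absurd hy2.1 (not_le.2 (h1.trans_lt (max_lt h2 hxa)))
    · have hxb : b < x := by
        by_contra hle; exact hxab ⟨hxa, not_lt.1 hle⟩
      have hx0 : 0 ≤ x := (hs ha).1.le.trans hxa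
      change ∫ y in (0 : ℝ)..x, ψ y = 0
      rw [intervalIntegral.integral_of_le hx0, setIntegral_eq_integral_of_forall_compl_eq_zero, h0]
      intro y hy
      refine hzero y fun hy2 => hy ⟨(hs ha).1.trans_le hy2.1, hy2.2.trans hxb.le⟩
  have hderiv : deriv (fun x => ∫ y in (0 : ℝ)..x, ψ y) = ψ := funext fun x => (hd x).deriv
  refine ⟨_, contDiff_infty_iff_deriv.2 ⟨fun x => (hd x).differentiableAt, by rw [hderiv]; exact h⟩,
    isCompact_Icc.of_isClosed_subset (isClosed_tsupport _) hsub, hsub.trans fun x hx =>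
      ⟨(hs ha).1.trans_le hx.1, hx.2.trans_lt (hs hb).2⟩, hderiv⟩

/-- The du Bois-Reymond lemma on the unit interval. -/
theorem IsTestDeriv.ae_eq_const {w : I → ℝ} (hw : Integrable w) (h : IsTestDeriv w 0) :
    ∃ c : ℝ, ∀ᵐ t, w t = c := by
  let b : ContDiffBump (1 / 2 : ℝ) := ⟨1 / 8, 1 / 4, by norm_num, by norm_num⟩
  set η := b.normed volume with hη
  have ηs : ContDiff ℝ ∞ η := b.contDiff_normed
  have ηt : tsupport η ⊆ Ioo (0 : ℝ) 1 := by
    rw [hη, b.tsupport_normed_eq, Real.closedBall_eq_Icc]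
    intro x hx
    have h1 : (1 / 2 : ℝ) - 1 / 4 ≤ x := hx.1
    have h2 : x ≤ (1 / 2 : ℝ) + 1 / 4 := hx.2
    constructor <;> linarith
  have ηc : HasCompactSupport η := b.hasCompactSupport_normed
  have η1 : ∫ x, η x = 1 := b.integral_normed
  set c := ∫ t : I, η t * w t with hc
  refine ⟨c, ?_⟩
  have mulw : ∀ {F : ℝ → ℝ}, Continuous F → Integrable fun t : I => F t * w t := by
    intro F hF
    obtain ⟨C, hC⟩ := isCompact_univ.exists_bound_of_continuousOn
      (f := fun t : I => F t) (by fun_prop)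
    exact hw.bdd_mul (c := C) (by fun_prop) (Filter.Eventually.of_forall fun t => hC t (mem_univ t))
  have out : ∀ {F : ℝ → ℝ}, tsupport F ⊆ Ioo (0 : ℝ) 1 → ∀ x, x ∉ Ioo (0 : ℝ) 1 → F x = 0 :=
    fun hF x hx => image_eq_zero_of_notMem_tsupport fun h => hx (hF h)
  set W : ℝ → ℝ := fun x => w (projIcc 0 1 zero_le_one x) with hW
  have hWt : ∀ t : I, W t = w t := fun t => by simp only [hW, projIcc_val]
  have hWi : IntegrableOn (fun x => W x - c) (Icc 0 1) := by
    rw [integrableOn_iff_comap_subtypeVal measurableSet_Icc]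
    have : (fun x => W x - c) ∘ Subtype.val = fun t : I => w t - c := by
      ext t; simp only [Function.comp, hWt]
    rw [this]
    exact hw.sub (integrable_const c)
  have main : ∀ᵐ x : ℝ, x ∈ Ioo (0 : ℝ) 1 → W x - c = 0 := by
    refine isOpen_Ioo.ae_eq_zero_of_integral_contDiff_smul_eq_zero
      (hWi.mono_set Ioo_subset_Icc_self).locallyIntegrableOn fun φ φs φc φt => ?_
    -- Subtracting `m` times the bump `η` of mass one gives a test function of integral zero, that
    -- is, the derivative of another test function. The hypothesis on `w` then yields `∫ φ w = m c =
    -- ∫ φ c`.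
    set m := ∫ x, φ x with hm
    have ψt : tsupport (fun x => φ x - m * η x) ⊆ Ioo (0 : ℝ) 1 :=
      (tsupport_sub _ _).trans (union_subset φt
        ((tsupport_mul_subset_right (f := fun _ => m)).trans ηt))
    have ψc : HasCompactSupport (fun x => φ x - m * η x) := φc.sub ηc.mul_left
    have φi : Integrable φ := φs.continuous.integrable_of_hasCompactSupport φc
    have ηi : Integrable η := ηs.continuous.integrable_of_hasCompactSupport ηc
    obtain ⟨g, gs, gc, gt, gd⟩ := exists_primitive_test (φs.sub (contDiff_const.mul ηs)) ψc ψt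
      (by rw [integral_sub φi (ηi.const_mul m), integral_const_mul, η1, ← hm]; ring)
    have h1 := h g gs gc gt
    rw [gd] at h1
    simp only [Pi.zero_apply, mul_zero, integral_zero, neg_zero, sub_mul, mul_assoc] at h1
    rw [integral_sub (mulw φs.continuous) ((mulw ηs.continuous).const_mul m), integral_const_mul,
      ← hc] at h1
    rw [← integral_unitInterval_eq_integral (F := fun x => φ x • (W x - c))
      fun x hx => by simp [out φt x hx]]
    simp only [smul_eq_mul, hWt, mul_sub]
    have φI : Integrable fun t : I => φ t := Continuous.integrable_unitInterval
      (φs.continuous.comp continuous_subtype_val)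
    rw [integral_sub (mulw φs.continuous) (φI.mul_const c), integral_mul_const,
      integral_unitInterval_eq_integral (out φt), ← hm]
    exact h1
  have main2 : ∀ᵐ t : I, (t : ℝ) ∈ Ioo (0 : ℝ) 1 → W t - c = 0 :=
    unitInterval.measurePreserving_coe.quasiMeasurePreserving.ae (ae_restrict_of_ae main)
  have e0 : ∀ᵐ t : I, t ≠ 0 := by simp [ae_iff]
  have e1 : ∀ᵐ t : I, t ≠ 1 := by simp [ae_iff]
  filter_upwards [main2, e0, e1] with t ht h0 h1
  have := ht ⟨unitInterval.pos_iff_ne_zero.2 h0, unitInterval.lt_one_iff_ne_one.2 h1⟩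
  rw [hWt] at this
  linarith

/-- The primitive of an integrable function has this function as its weak derivative. -/
theorem isTestDeriv_primitive {v : I → ℝ} (hv : Integrable v) :
    IsTestDeriv (fun t => ∫ s, (Iic t).indicator v s) v := by
  intro g gs gc gt
  have cg : Continuous (deriv g) := gs.continuous_deriv (by simp)
  have h1 : ∀ t : I, deriv g t * ∫ s, (Iic t).indicator v s
      = ∫ s, deriv g t * (Iic t).indicator v s := fun t => (integral_const_mul _ _).symm
  have hmeas : MeasurableSet {z : I × I | z.2 ≤ z.1} := measurableSet_le measurable_snd measurable_fst
  have e : (Function.uncurry fun t s : I => deriv g t * (Iic t).indicator v s)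
      = {z : I × I | z.2 ≤ z.1}.indicator fun z => deriv g z.1 * v z.2 := by
    ext ⟨t, s⟩
    by_cases h : s ≤ t <;> simp [indicator, h]
  have hint : Integrable (Function.uncurry fun t s : I => deriv g t * (Iic t).indicator v s)
      ((volume : Measure I).prod volume) := by
    rw [e]
    refine Integrable.indicator ?_ hmeas
    exact Integrable.mul_prod (f := fun t : I => deriv g t)
      (Continuous.integrable_unitInterval (by fun_prop)) hv
  simp_rw [h1]
  rw [integral_integral_swap hint, ← integral_neg]
  refine integral_congr_ae (Filter.Eventually.of_forall fun s => ?_)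
  have h2 : ∀ t : I, deriv g t * (Iic t).indicator v s
      = (Ici s).indicator (fun t : I => deriv g t) t * v s := fun t => by
    by_cases h : s ≤ t <;> simp [indicator, h]
  simp only [h2]
  rw [integral_mul_const]
  -- After Fubini the inner integral is `∫ g'` over `[s,1]`, and `g 1 = 0`.
  have h3 : ∫ t : I, (Ici s).indicator (fun t : I => deriv g t) t = - g s := by
    have h4 : (fun t : I => (Ici s).indicator (fun t : I => deriv g t) t)
        = fun t : I => (Ici (s : ℝ)).indicator (deriv g) t := by
      ext t
      by_cases h : s ≤ t <;> simp [indicator, h]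
    rw [h4, integral_unitInterval_eq (fun x => (Ici (s : ℝ)).indicator (deriv g) x),
      intervalIntegral.integral_of_le zero_le_one, ← integral_Icc_eq_integral_Ioc,
      setIntegral_indicator measurableSet_Ici]
    have h5 : Icc (0 : ℝ) 1 ∩ Ici (s : ℝ) = Icc (s : ℝ) 1 := by
      ext x; simp only [mem_inter_iff, mem_Icc, mem_Ici]
      exact ⟨fun h => ⟨h.2, h.1.2⟩, fun h => ⟨⟨s.2.1.trans h.1, h.2⟩, h.1⟩⟩
    rw [h5, integral_Icc_eq_integral_Ioc, ← intervalIntegral.integral_of_le s.2.2,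
      intervalIntegral.integral_deriv_eq_sub
        (fun x _ => (gs.differentiable (by simp)) x) (cg.intervalIntegrable _ _)]
    have : g 1 = 0 := image_eq_zero_of_notMem_tsupport fun h => (gt h).2.ne rfl
    rw [this]; ring
  rw [h3]; ring

theorem IsTestDeriv.sub {u u' v v' : I → ℝ} (hu : Integrable u) (hu' : Integrable u')
    (hv : Integrable v) (hv' : Integrable v') (h1 : IsTestDeriv u u') (h2 : IsTestDeriv v v') :
    IsTestDeriv (fun t => u t - v t) (fun t => u' t - v' t) := by
  intro g gs gc gt
  have cg : Continuous (deriv g) := gs.continuous_deriv (by simp)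
  have mulw : ∀ {F : ℝ → ℝ} {w : I → ℝ}, Continuous F → Integrable w →
      Integrable fun t : I => F t * w t := by
    intro F w hF hw
    obtain ⟨C, hC⟩ := isCompact_univ.exists_bound_of_continuousOn
      (f := fun t : I => F t) (by fun_prop)
    exact hw.bdd_mul (c := C) (by fun_prop) (Filter.Eventually.of_forall fun t => hC t (mem_univ t))
  simp only [mul_sub]
  rw [integral_sub (mulw cg hu) (mulw cg hv), integral_sub (mulw gs.continuous hu')
    (mulw gs.continuous hv'), h1 g gs gc gt, h2 g gs gc gt]
  ring

/-- A weakly differentiable function is, up to a constant, the primitive of its weak derivative. -/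
theorem IsTestDeriv.exists_ae_eq {u v : I → ℝ} (hu : Integrable u) (hv : Integrable v)
    (h : IsTestDeriv u v) : ∃ c : ℝ, ∀ᵐ t, u t = c + ∫ s, (Iic t).indicator v s := by
  have hV : Integrable fun t : I => ∫ s, (Iic t).indicator v s := by
    have hmeas : MeasurableSet {z : I × I | z.2 ≤ z.1} :=
      measurableSet_le measurable_snd measurable_fst
    have hint : Integrable ({z : I × I | z.2 ≤ z.1}.indicator fun z => v z.2)
        ((volume : Measure I).prod volume) := (hv.comp_snd volume).indicator hmeas
    refine hint.integral_prod_left.congr (Filter.Eventually.of_forall fun t => ?_)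
    refine integral_congr_ae (Filter.Eventually.of_forall fun s => ?_)
    by_cases h : s ≤ t <;> simp [indicator, h]
  have h1 := h.sub hu hv hV hv (isTestDeriv_primitive hv)
  have h2 : IsTestDeriv (fun t => u t - ∫ s, (Iic t).indicator v s) 0 := by
    simpa [Pi.zero_def] using h1
  obtain ⟨c, hc⟩ := h2.ae_eq_const (hu.sub hV)
  exact ⟨c, hc.mono fun t ht => by simp only [Pi.sub_apply] at ht; linarith⟩

/-! ### The dual logarithmic Sobolev inequality for weakly differentiable functions -/

theorem integral_sq_eq_eLpNorm_sq {α : Type*} {mα : MeasurableSpace α} {μ : Measure α}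
    {f : α → ℝ} (hf : MemLp f 2 μ) : ∫ x, f x ^ 2 ∂μ = (eLpNorm f 2 μ).toReal ^ 2 := by
  rw [hf.eLpNorm_eq_integral_rpow_norm (by simp) (by simp)]
  have h0 : 0 ≤ ∫ x, f x ^ 2 ∂μ := integral_nonneg fun x => sq_nonneg _
  have h1 : ∀ x, ‖f x‖ ^ (2 : ℝ≥0∞).toReal = f x ^ 2 := fun x => by
    simp [Real.norm_eq_abs]
  simp only [h1]
  rw [ENNReal.toReal_ofReal (by positivity), ENNReal.toReal_ofNat, ← Real.rpow_natCast,
    ← Real.rpow_mul h0]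
  simp

theorem sin_pi_mul_pos {t : ℝ} (h0 : 0 < t) (h1 : t < 1) : 0 < Real.sin (Real.pi * t) :=
  Real.sin_pos_of_pos_of_lt_pi (by positivity) (by nlinarith [Real.pi_pos])

/-- Weierstrass approximation after the change of variable `y = cos (π t)`, a homeomorphism from
`[0,1]` onto `[-1,1]`. -/
theorem exists_polynomial_eval_cos_near (r : C(I, ℝ)) {ε : ℝ} (hε : 0 < ε) :
    ∃ Q : Polynomial ℝ, ∀ t : I, |r t - Q.eval (Real.cos (Real.pi * t))| ≤ ε := by
  obtain ⟨Q, hQ⟩ := exists_polynomial_near_of_continuousOn (-1) 1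
    (fun y => r (projIcc 0 1 zero_le_one (Real.arccos y / Real.pi)))
    (Continuous.continuousOn (r.continuous.comp (continuous_projIcc.comp
      (Real.continuous_arccos.div_const _)))) ε hε
  refine ⟨Q, fun t => ?_⟩
  have h := hQ (Real.cos (Real.pi * t)) ⟨Real.neg_one_le_cos _, Real.cos_le_one _⟩
  rw [Real.arccos_cos (mul_nonneg Real.pi_pos.le t.2.1)
    (mul_le_of_le_one_right Real.pi_pos.le t.2.2), mul_div_cancel_left₀ _ Real.pi_pos.ne',
    projIcc_val] at h
  rw [abs_sub_comm]
  exact h.le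

/-- Derivatives of polynomials in `cos (π t)` carry a factor `sin (π t)`, so `v` has to be divided
by it. This is harmless once `v` is cut off near the endpoints; the quotient is then approximated by
a continuous function, and that one uniformly by a polynomial in the cosine. -/
theorem exists_sin_mul_eval_cos_near {v : I → ℝ} (hv : MemLp v 2) {ε : ℝ} (hε : 0 < ε) :
    ∃ Q : Polynomial ℝ, eLpNorm (fun t : I => v t - Real.sin (Real.pi * t) *
      Q.eval (Real.cos (Real.pi * t))) 2 ≤ ENNReal.ofReal ε := by
  have hε3 : 0 < ε / 3 := by positivity
  obtain ⟨δ, hδ, hδs⟩ := hv.eLpNorm_indicator_le (by norm_num) (by simp) hε3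
  -- Two end pieces of length at most `δ/2` have total measure at most `δ`; the bound `1/4` keeps `a
  -- ≤ b`.
  set η : ℝ := min (δ / 2) (1 / 4) with hη
  have hη0 : 0 < η := by positivity
  have hη1 : η ≤ 1 / 4 := min_le_right _ _
  have hη2 : η ≤ δ / 2 := min_le_left _ _
  let a : I := ⟨η, hη0.le, by linarith⟩
  let b : I := ⟨1 - η, by linarith, by linarith⟩
  have hKc : volume (Icc a b)ᶜ ≤ ENNReal.ofReal δ := by
    rw [prob_compl_eq_one_sub measurableSet_Icc, unitInterval.volume_Icc, ← ENNReal.ofReal_one,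
      ← ENNReal.ofReal_sub _ (by simp only [a, b]; linarith)]
    exact ENNReal.ofReal_le_ofReal (by simp only [a, b]; linarith)
  have hpos : ∀ t ∈ Icc a b, 0 < Real.sin (Real.pi * t) := fun t ht => by
    have h1 : η ≤ (t : ℝ) := ht.1
    have h2 : (t : ℝ) ≤ 1 - η := ht.2
    exact sin_pi_mul_pos (by linarith) (by linarith)
  obtain ⟨C, hC⟩ := (isCompact_Icc (a := a) (b := b)).exists_bound_of_continuousOn
    (f := fun t : I => (Real.sin (Real.pi * t))⁻¹)
    (ContinuousOn.inv₀ (by fun_prop) fun t ht => (hpos t ht).ne')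
  set w : I → ℝ := (Icc a b).indicator fun t => (Real.sin (Real.pi * t))⁻¹ * v t with hw
  have hwm : MemLp w 2 := by
    refine MemLp.of_le_mul (c := C) hv ?_ (Filter.Eventually.of_forall fun t => ?_)
    · have hms : Measurable fun t : I => (Real.sin (Real.pi * t))⁻¹ := by fun_prop
      exact (hms.aestronglyMeasurable.mul hv.1).indicator measurableSet_Icc
    · by_cases ht : t ∈ Icc a b
      · rw [hw, indicator_of_mem ht, norm_mul]
        exact mul_le_mul_of_nonneg_right (hC t ht) (norm_nonneg _)
      · have hC0 : 0 ≤ C := (norm_nonneg _).trans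
          (hC a ⟨le_rfl, by change η ≤ 1 - η; linarith⟩)
        rw [hw, indicator_of_notMem ht, norm_zero]
        positivity
  obtain ⟨r, hr, hrm⟩ := hwm.exists_boundedContinuous_eLpNorm_sub_le (by simp)
    (ε := ENNReal.ofReal (ε / 3)) (by simpa using hε3)
  obtain ⟨Q, hQ⟩ := exists_polynomial_eval_cos_near r.toContinuousMap hε3
  refine ⟨Q, ?_⟩
  have hsplit : (fun t : I => v t - Real.sin (Real.pi * t) * Q.eval (Real.cos (Real.pi * t)))
      = ((Icc a b)ᶜ.indicator v + fun t : I => Real.sin (Real.pi * t) * (w t - r t))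
        + fun t : I => Real.sin (Real.pi * t) * (r t - Q.eval (Real.cos (Real.pi * t))) := by
    ext t
    simp only [Pi.add_apply]
    by_cases ht : t ∈ Icc a b
    · rw [indicator_of_notMem (by simpa using ht), hw, indicator_of_mem ht]
      have := (hpos t ht).ne'
      field_simp; ring
    · rw [indicator_of_mem (by simpa using ht), hw, indicator_of_notMem ht]
      ring
  have hsin : Continuous fun t : I => Real.sin (Real.pi * t) := by fun_prop
  have m1 : AEStronglyMeasurable ((Icc a b)ᶜ.indicator v) volume :=
    hv.1.indicator measurableSet_Icc.compl
  have m2 : AEStronglyMeasurable (fun t : I => Real.sin (Real.pi * t) * (w t - r t)) volume :=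
    hsin.aestronglyMeasurable.mul (hwm.1.sub hrm.1)
  have m3 : AEStronglyMeasurable
      (fun t : I => Real.sin (Real.pi * t) * (r t - Q.eval (Real.cos (Real.pi * t)))) volume :=
    Continuous.aestronglyMeasurable (by fun_prop)
  rw [hsplit]
  refine (eLpNorm_add_le (m1.add m2) m3 (by norm_num)).trans ?_
  have h1 : eLpNorm ((Icc a b)ᶜ.indicator v) 2 volume ≤ ENNReal.ofReal (ε / 3) :=
    hδs _ measurableSet_Icc.compl hKc
  have h2 : eLpNorm (fun t : I => Real.sin (Real.pi * t) * (w t - r t)) 2 volume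
      ≤ ENNReal.ofReal (ε / 3) := by
    refine le_trans (eLpNorm_mono fun t => ?_) hr
    rw [norm_mul]
    exact mul_le_of_le_one_left (norm_nonneg _) (Real.abs_sin_le_one _)
  have h3 : eLpNorm (fun t : I => Real.sin (Real.pi * t) *
      (r t - Q.eval (Real.cos (Real.pi * t)))) 2 volume ≤ ENNReal.ofReal (ε / 3) := by
    refine (eLpNorm_le_of_ae_bound (C := ε / 3) (Filter.Eventually.of_forall fun t => ?_)).trans
      (by simp)
    rw [norm_mul]
    exact (mul_le_of_le_one_left (norm_nonneg _) (Real.abs_sin_le_one _)).trans (hQ t)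
  refine (add_le_add ((eLpNorm_add_le m1 m2 (by norm_num)).trans (add_le_add h1 h2)) h3).trans ?_
  rw [← ENNReal.ofReal_add hε3.le hε3.le, ← ENNReal.ofReal_add (by positivity) hε3.le]
  exact ENNReal.ofReal_le_ofReal (by linarith)

theorem Polynomial.exists_derivative_eq (Q : Polynomial ℝ) :
    ∃ P : Polynomial ℝ, P.derivative = Q := by
  induction Q using Polynomial.induction_on' with
  | add P Q hP hQ =>
    obtain ⟨P', rfl⟩ := hP
    obtain ⟨Q', rfl⟩ := hQ
    exact ⟨P' + Q', Polynomial.derivative_add⟩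
  | monomial n a =>
    refine ⟨Polynomial.monomial (n + 1) (a / (n + 1)), ?_⟩
    rw [Polynomial.derivative_monomial]
    have : (n : ℝ) + 1 ≠ 0 := by positivity
    congr 1
    push_cast
    field_simp

/-- Weakly differentiable functions are approximated, together with their weak derivatives, by
polynomials in `cos (π t)`. -/
theorem IsTestDeriv.exists_eval_cos_near {u v : I → ℝ} (hu : MemLp u 2) (hv : MemLp v 2)
    (h : IsTestDeriv u v) {ε : ℝ} (hε : 0 < ε) :
    ∃ P : Polynomial ℝ, ∫ t : I, (u t - P.eval (Real.cos (Real.pi * t))) ^ 2 ≤ ε ^ 2 ∧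
      ∫ t : I, (v t - P.derivative.eval (Real.cos (Real.pi * t)) *
        (-Real.pi * Real.sin (Real.pi * t))) ^ 2 ≤ ε ^ 2 := by
  have hvi : Integrable v := hv.integrable (by norm_num)
  obtain ⟨c, hc⟩ := h.exists_ae_eq (hu.integrable (by norm_num)) hvi
  obtain ⟨Q, hQ⟩ := exists_sin_mul_eval_cos_near hv hε
  obtain ⟨P₀, hP₀⟩ := Polynomial.exists_derivative_eq (Polynomial.C (-Real.pi⁻¹) * Q)
  -- The constant makes `P (cos 0) = P 1 = c`, the value at `t = 0` of the primitive representing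
  -- `u`.
  set P := P₀ + Polynomial.C (c - P₀.eval 1) with hP
  have hPd : P.derivative = Polynomial.C (-Real.pi⁻¹) * Q := by simp [hP, hP₀]
  set p : ℝ → ℝ := fun x => Real.sin (Real.pi * x) * Q.eval (Real.cos (Real.pi * x)) with hp
  have hpe : ∀ x, P.derivative.eval (Real.cos (Real.pi * x)) * (-Real.pi * Real.sin (Real.pi * x))
      = p x := fun x => by
    rw [hPd]
    have := Real.pi_pos.ne'
    simp only [Polynomial.eval_mul, Polynomial.eval_C, hp]
    field_simp
  have cp : Continuous p := by simp only [hp]; fun_prop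
  have hpi : Integrable fun t : I => p t :=
    Continuous.integrable_unitInterval (cp.comp continuous_subtype_val)
  have hpm : AEStronglyMeasurable (fun t : I => p t) volume := hpi.1
  have hvp : MemLp (fun t : I => v t - p t) 2 :=
    ⟨hv.1.sub hpm, hQ.trans_lt ENNReal.ofReal_lt_top⟩
  have hsq : ∫ t : I, (v t - p t) ^ 2 ≤ ε ^ 2 := by
    rw [integral_sq_eq_eLpNorm_sq hvp]
    exact pow_le_pow_left₀ ENNReal.toReal_nonneg (ENNReal.toReal_le_of_le_ofReal hε.le hQ) 2
  have habs : ∫ t : I, |v t - p t| ≤ ε := by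
    have h1 : eLpNorm (fun t : I => v t - p t) 1 volume ≤ ENNReal.ofReal ε :=
      (eLpNorm_le_eLpNorm_of_exponent_le (by norm_num) hvp.1).trans hQ
    rw [eLpNorm_one_eq_lintegral_enorm] at h1
    have h2 := integral_norm_eq_lintegral_enorm hvp.1
    simp only [Real.norm_eq_abs] at h2
    rw [h2]
    exact ENNReal.toReal_le_of_le_ofReal hε.le h1
  have hprim : ∀ t : I, P.eval (Real.cos (Real.pi * t)) = c + ∫ s : I, (Iic t).indicator
      (fun s : I => p s) s := fun t => by
    have d : ∀ x, HasDerivAt (fun x => P.eval (Real.cos (Real.pi * x))) (p x) x := fun x => by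
      have h1 := (((hasDerivAt_id x).const_mul Real.pi).cos)
      have h2 := (P.hasDerivAt (Real.cos (Real.pi * x))).comp x h1
      refine h2.congr_deriv ?_
      rw [← hpe x]; simp only [id]; ring
    have h4 : (fun s : I => (Iic t).indicator (fun s : I => p s) s)
        = fun s : I => (Iic (t : ℝ)).indicator p s := by
      ext s
      by_cases h : s ≤ t <;> simp [indicator, h]
    rw [h4, integral_unitInterval_eq (fun x => (Iic (t : ℝ)).indicator p x),
      intervalIntegral.integral_of_le zero_le_one, setIntegral_indicator measurableSet_Iic]
    have h5 : Ioc (0 : ℝ) 1 ∩ Iic (t : ℝ) = Ioc 0 (t : ℝ) := by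
      ext x; simp only [mem_inter_iff, mem_Ioc, mem_Iic]
      exact ⟨fun h => ⟨h.1.1, h.2⟩, fun h => ⟨⟨h.1, h.2.trans t.2.2⟩, h.2⟩⟩
    rw [h5, ← intervalIntegral.integral_of_le t.2.1,
      intervalIntegral.integral_eq_sub_of_hasDerivAt (fun x _ => d x) (cp.intervalIntegrable _ _)]
    simp [hP]
  refine ⟨P, ?_, by simpa only [hpe] using hsq⟩
  -- The error in `u` is the primitive of the error in `v`, so it is at most the `L¹` norm of the
  -- latter, which is bounded by its `L²` norm.
  have hbound : ∀ᵐ t : I, (u t - P.eval (Real.cos (Real.pi * t))) ^ 2 ≤ ε ^ 2 := by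
    filter_upwards [hc] with t ht
    have e : u t - P.eval (Real.cos (Real.pi * t))
        = ∫ s : I, (Iic t).indicator (fun s : I => v s - p s) s := by
      rw [ht, hprim]
      have e2 : (fun s : I => (Iic t).indicator (fun s : I => v s - p s) s)
          = fun s => (Iic t).indicator v s - (Iic t).indicator (fun s : I => p s) s := by
        ext s; by_cases h : s ≤ t <;> simp [indicator, h]
      rw [e2, integral_sub (hvi.indicator measurableSet_Iic) (hpi.indicator measurableSet_Iic)]
      ring
    rw [e, sq_le_sq, abs_of_pos hε]
    refine le_trans (norm_integral_le_integral_norm (fun s : I =>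
      (Iic t).indicator (fun s : I => v s - p s) s)) (le_trans ?_ habs)
    refine integral_mono ((hvi.sub hpi).indicator measurableSet_Iic).norm (hvi.sub hpi).norm
      fun s => norm_indicator_le_norm_self _ _
  calc ∫ t : I, (u t - P.eval (Real.cos (Real.pi * t))) ^ 2
      ≤ ∫ _ : I, ε ^ 2 := integral_mono_of_nonneg (Filter.Eventually.of_forall fun t => sq_nonneg _)
        (integrable_const _) hbound
    _ = ε ^ 2 := by simp

/-- The dual logarithmic Sobolev inequality on the unit interval. -/
theorem IsTestDeriv.dual_logSobolev {u v : I → ℝ} (hu : MemLp u 2) (hv : MemLp v 2)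
    (huv : IsTestDeriv u v) {h : I → ℝ} (hm : Measurable h) {C : ℝ}
    (hb : ∀ t, |h t| ≤ C) (hexp : ∫ t, Real.exp (h t) ≤ 1) :
    ∫ t, u t ^ 2 * h t ≤ 2 / Real.pi ^ 2 * ∫ t, v t ^ 2 := by
  have hC : 0 ≤ C := (abs_nonneg _).trans (hb 0)
  set K := 2 / Real.pi ^ 2 with hK
  have hK0 : 0 ≤ K := by positivity
  set A := ∫ t, u t ^ 2 with hA
  set B := ∫ t, v t ^ 2 with hB
  have hu2 : Integrable fun t => u t ^ 2 := hu.integrable_sq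
  have hv2 : Integrable fun t => v t ^ 2 := hv.integrable_sq
  have mulh : ∀ {F : I → ℝ}, Integrable F → Integrable fun t => F t * h t := fun hF =>
    hF.mul_bdd (c := C) hm.aestronglyMeasurable (Filter.Eventually.of_forall hb)
  -- The approximation is taken to accuracy `δ`, and cross terms are split by `2|x||y| ≤ δx² +
  -- y²/δ`. The squared errors thus have weight `1 + 1/δ` and contribute at most `δ² + δ`, which
  -- still vanishes with `δ`.
  have key : ∀ δ : ℝ, 0 < δ → ∫ t, u t ^ 2 * h t ≤
      K * ((1 + δ) * B + (δ ^ 2 + δ)) + C * (δ * A + (δ ^ 2 + δ)) := by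
    intro δ hδ
    obtain ⟨P, hP1, hP2⟩ := huv.exists_eval_cos_near hu hv hδ
    have hP := dual_logSobolev_eval_cos P hm hb hexp
    set p : I → ℝ := fun t => P.eval (Real.cos (Real.pi * t)) with hp
    set q : I → ℝ := fun t => P.derivative.eval (Real.cos (Real.pi * t)) *
      (-Real.pi * Real.sin (Real.pi * t)) with hq
    have cp : Continuous p := by simp only [hp]; fun_prop
    have cq : Continuous q := by simp only [hq]; fun_prop
    have mem : ∀ {F : I → ℝ}, Continuous F → MemLp F 2 := fun {F} hF => by
      obtain ⟨M, hM⟩ := isCompact_univ.exists_bound_of_continuousOn hF.continuousOn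
      exact MemLp.of_bound hF.aestronglyMeasurable M
        (Filter.Eventually.of_forall fun t => hM t (mem_univ t))
    have hw2 : Integrable fun t => (u t - p t) ^ 2 := (hu.sub (mem cp)).integrable_sq
    have hz2 : Integrable fun t => (v t - q t) ^ 2 := (hv.sub (mem cq)).integrable_sq
    have hp2 : Integrable fun t => p t ^ 2 := (mem cp).integrable_sq
    have hq2 : Integrable fun t => q t ^ 2 := (mem cq).integrable_sq
    have young : ∀ x y : ℝ, 2 * |x| * |y| ≤ δ * x ^ 2 + δ⁻¹ * y ^ 2 := fun x y => by
      have h1 : δ * x ^ 2 + δ⁻¹ * y ^ 2 - 2 * |x| * |y| = δ⁻¹ * (δ * |x| - |y|) ^ 2 := by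
        rw [← sq_abs x, ← sq_abs y]; field_simp; ring
      have : 0 ≤ δ⁻¹ * (δ * |x| - |y|) ^ 2 := by positivity
      linarith
    have hδe : (1 + δ⁻¹) * δ ^ 2 = δ ^ 2 + δ := by field_simp
    have e1 : ∫ t, u t ^ 2 * h t ≤
        ∫ t, (p t ^ 2 * h t + C * (δ * u t ^ 2 + (1 + δ⁻¹) * (u t - p t) ^ 2)) := by
      refine integral_mono (mulh hu2) ((mulh hp2).add (((hu2.const_mul δ).add
        (hw2.const_mul _)).const_mul C)) fun t => ?_
      simp only
      have h1 := young (u t) (u t - p t)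
      have h2 : u t ^ 2 * h t - p t ^ 2 * h t
          = (2 * u t * (u t - p t) - (u t - p t) ^ 2) * h t := by ring
      have h3 : |2 * u t * (u t - p t) - (u t - p t) ^ 2| ≤
          δ * u t ^ 2 + (1 + δ⁻¹) * (u t - p t) ^ 2 := by
        refine (abs_sub _ _).trans ?_
        rw [abs_mul, abs_mul, abs_two, abs_of_nonneg (sq_nonneg (u t - p t))]
        linarith
      have h4 := (le_abs_self _).trans_eq
        (abs_mul (2 * u t * (u t - p t) - (u t - p t) ^ 2) (h t))
      have h5 := mul_le_mul h3 (hb t) (abs_nonneg _) (by positivity)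
      linarith
    have e2 : ∫ t, q t ^ 2 ≤ ∫ t, ((1 + δ) * v t ^ 2 + (1 + δ⁻¹) * (v t - q t) ^ 2) := by
      refine integral_mono hq2 ((hv2.const_mul _).add (hz2.const_mul _)) fun t => ?_
      simp only
      have h1 := young (v t) (v t - q t)
      have h2 : -(v t * (v t - q t)) ≤ |v t| * |v t - q t| := by
        rw [← abs_mul]; exact neg_le_abs _
      nlinarith
    have i1 : Integrable fun t => δ * u t ^ 2 + (1 + δ⁻¹) * (u t - p t) ^ 2 :=
      (hu2.const_mul δ).add (hw2.const_mul _)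
    rw [integral_add (mulh hp2) (i1.const_mul C),
      integral_const_mul, integral_add (hu2.const_mul δ) (hw2.const_mul _), integral_const_mul,
      integral_const_mul] at e1
    rw [integral_add (hv2.const_mul _) (hz2.const_mul _), integral_const_mul,
      integral_const_mul] at e2
    have hδ0 : 0 ≤ 1 + δ⁻¹ := by positivity
    have e3 := mul_le_mul_of_nonneg_left hP1 hδ0
    have e4 := mul_le_mul_of_nonneg_left hP2 hδ0
    rw [hδe] at e3 e4
    have e5 : ∫ t, q t ^ 2 ≤ (1 + δ) * B + (δ ^ 2 + δ) := by linarith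
    have e6 := mul_le_mul_of_nonneg_left e5 hK0
    have e7 : C * (δ * A + (1 + δ⁻¹) * ∫ t, (u t - p t) ^ 2) ≤ C * (δ * A + (δ ^ 2 + δ)) :=
      mul_le_mul_of_nonneg_left (by linarith) hC
    linarith
  have hlim : Filter.Tendsto
      (fun δ : ℝ => K * ((1 + δ) * B + (δ ^ 2 + δ)) + C * (δ * A + (δ ^ 2 + δ)))
      (nhdsWithin 0 (Ioi 0)) (nhds (K * B)) := by
    have hc : Continuous
        fun δ : ℝ => K * ((1 + δ) * B + (δ ^ 2 + δ)) + C * (δ * A + (δ ^ 2 + δ)) := by fun_prop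
    have := (hc.tendsto 0).mono_left (nhdsWithin_le_nhds (s := Ioi 0))
    simpa using this
  exact ge_of_tendsto hlim (Filter.eventually_of_mem self_mem_nhdsWithin key)

/-! ### Averaging over the tail coordinates of the infinite product -/

instance : IsProbabilityMeasure uniformProd := by unfold uniformProd; infer_instance

/-- The point whose first `n` coordinates are those of `x` and whose other coordinates are those
of `y`. -/
def mixHead (n : ℕ) (x y : ℕ → I) : ℕ → I := fun k => if k < n then x k else y k

theorem mixHead_zero (x y : ℕ → I) : mixHead 0 x y = y := by ext k; simp [mixHead]

theorem mixHead_mixHead_left (n : ℕ) (x y z : ℕ → I) :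
    mixHead n (mixHead n x y) z = mixHead n x z := by
  ext k; by_cases h : k < n <;> simp [mixHead, h]

theorem mixHead_mixHead_of_le {n m : ℕ} (h : n ≤ m) (x y z : ℕ → I) :
    mixHead n (mixHead m x y) z = mixHead n x z := by
  ext k
  by_cases hk : k < n
  · simp [mixHead, hk, hk.trans_le h]
  · simp [mixHead, hk]

theorem mixHead_update_of_lt {n i : ℕ} (h : i < n) (x y : ℕ → I) (t : I) :
    mixHead n (Function.update x i t) y = Function.update (mixHead n x y) i t := by
  ext k
  by_cases hk : k = i
  · subst hk; simp [mixHead, h]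
  · simp [mixHead, Function.update_of_ne hk]

theorem mixHead_update_of_le {n i : ℕ} (h : n ≤ i) (x y : ℕ → I) (t : I) :
    mixHead n (Function.update x i t) y = mixHead n x y := by
  ext k
  by_cases hk : k < n
  · simp [mixHead, hk, Function.update_of_ne (hk.trans_le h).ne]
  · simp [mixHead, hk]

theorem update_mixHead_succ (n : ℕ) (x y : ℕ → I) (t : I) :
    Function.update (mixHead (n + 1) x y) n t = mixHead n x (Function.update y n t) := by
  ext k
  by_cases hk : k = n
  · subst hk; simp [mixHead]
  · have : k < n + 1 ↔ k < n := by omega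
    simp [mixHead, Function.update_of_ne hk, this]

theorem measurable_mixHead (n : ℕ) :
    Measurable fun z : (ℕ → I) × (ℕ → I) => mixHead n z.1 z.2 := by
  refine measurable_pi_lambda _ fun k => ?_
  by_cases h : k < n
  · simp only [mixHead, h, if_true]; fun_prop
  · simp only [mixHead, h, if_false]; fun_prop

theorem measurable_update_prod (i : ℕ) :
    Measurable fun z : (ℕ → I) × I => Function.update z.1 i z.2 := by
  refine measurable_pi_lambda _ fun k => ?_
  by_cases h : k = i
  · subst h; simp only [Function.update_self]; fun_prop
  · simp only [Function.update_of_ne h]; fun_prop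

/-- Splicing two independent samples gives a sample: on a cylinder, the constraints split into those
before `n` on `x` and the remaining ones on `y`. -/
theorem measurePreserving_mixHead (n : ℕ) :
    MeasurePreserving (fun z : (ℕ → I) × (ℕ → I) => mixHead n z.1 z.2)
      (uniformProd.prod uniformProd) uniformProd := by
  refine ⟨measurable_mixHead n, ?_⟩
  refine Measure.eq_infinitePi _ fun s T hT => ?_
  rw [Measure.map_apply (measurable_mixHead n)
    (MeasurableSet.pi s.countable_toSet fun i _ => hT i)]
  have e : (fun z : (ℕ → I) × (ℕ → I) => mixHead n z.1 z.2) ⁻¹' (s : Set ℕ).pi T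
      = ((s.filter (· < n) : Finset ℕ) : Set ℕ).pi T ×ˢ
        ((s.filter (¬ · < n) : Finset ℕ) : Set ℕ).pi T := by
    ext ⟨x, y⟩
    simp only [mem_preimage, Set.mem_pi, mem_prod, Finset.coe_filter, mem_ofPred_eq, mixHead,
      Finset.mem_coe]
    constructor
    · intro h
      exact ⟨fun k hk => by simpa [hk.2] using h k hk.1,
        fun k hk => by simpa [hk.2] using h k hk.1⟩
    · intro h k hk
      by_cases hkn : k < n
      · simpa [hkn] using h.1 k ⟨hk, hkn⟩
      · simpa [hkn] using h.2 k ⟨hk, hkn⟩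
  rw [e, Measure.prod_prod, uniformProd, Measure.infinitePi_pi _ fun i _ => hT i,
    Measure.infinitePi_pi _ fun i _ => hT i, Finset.prod_filter_mul_prod_filter_not]

/-- Resampling one coordinate independently preserves the law, which is checked on cylinders. This
is the source of Fubini in a single coordinate. -/
theorem measurePreserving_update (i : ℕ) :
    MeasurePreserving (fun z : (ℕ → I) × I => Function.update z.1 i z.2)
      (uniformProd.prod volume) uniformProd := by
  refine ⟨measurable_update_prod i, ?_⟩
  refine Measure.eq_infinitePi _ fun s T hT => ?_
  rw [Measure.map_apply (measurable_update_prod i)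
    (MeasurableSet.pi s.countable_toSet fun i _ => hT i)]
  have e : (fun z : (ℕ → I) × I => Function.update z.1 i z.2) ⁻¹' (s : Set ℕ).pi T
      = ((s.erase i : Finset ℕ) : Set ℕ).pi T ×ˢ (if i ∈ s then T i else univ) := by
    ext ⟨x, t⟩
    simp only [mem_preimage, Set.mem_pi, mem_prod, Finset.coe_erase, Finset.mem_coe, mem_sdiff,
      mem_singleton_iff]
    constructor
    · intro h
      refine ⟨fun k hk => by simpa [Function.update_of_ne hk.2] using h k hk.1, ?_⟩
      split_ifs with hi
      · simpa using h i hi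
      · trivial
    · intro h k hk
      by_cases hki : k = i
      · subst hki; simpa [hk] using h.2
      · simpa [Function.update_of_ne hki] using h.1 k ⟨hk, hki⟩
  rw [e, Measure.prod_prod, uniformProd, Measure.infinitePi_pi _ fun i _ => hT i]
  split_ifs with hi
  · exact Finset.prod_erase_mul s _ hi
  · simp [Finset.erase_eq_of_notMem hi]

/-- The average of `f` over all coordinates but the first `n`. -/
noncomputable def headAvg (n : ℕ) (f : (ℕ → I) → ℝ) (x : ℕ → I) : ℝ :=
  ∫ y, f (mixHead n x y) ∂uniformProd

/-- The function `G` depends on the first `n` coordinates only. -/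
def IsHeadFun (n : ℕ) (G : (ℕ → I) → ℝ) : Prop := ∀ x y, G (mixHead n x y) = G x

theorem isHeadFun_headAvg (n : ℕ) (f : (ℕ → I) → ℝ) : IsHeadFun n (headAvg n f) := fun x y => by
  simp only [headAvg, mixHead_mixHead_left]

theorem IsHeadFun.mono {n m : ℕ} (h : n ≤ m) {G : (ℕ → I) → ℝ} (hG : IsHeadFun n G) :
    IsHeadFun m G := fun x y => by
  rw [← hG (mixHead m x y) x, mixHead_mixHead_of_le h, hG]

theorem IsHeadFun.headAvg_eq {n : ℕ} {G : (ℕ → I) → ℝ} (hG : IsHeadFun n G) :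
    headAvg n G = G := by
  ext x
  simp only [headAvg, hG x, integral_const, probReal_univ, one_smul]

theorem headAvg_zero (f : (ℕ → I) → ℝ) (x : ℕ → I) : headAvg 0 f x = ∫ y, f y ∂uniformProd := by
  simp only [headAvg, mixHead_zero]

theorem Measurable.headAvg {n : ℕ} {f : (ℕ → I) → ℝ} (hf : Measurable f) :
    Measurable (headAvg n f) :=
  ((hf.comp (measurable_mixHead n)).stronglyMeasurable.integral_prod_right').measurable

theorem integrable_comp_mixHead {f : (ℕ → I) → ℝ} (hf : Integrable f uniformProd)
    (n : ℕ) :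
    Integrable (fun z : (ℕ → I) × (ℕ → I) => f (mixHead n z.1 z.2))
      (uniformProd.prod uniformProd) :=
  ((measurePreserving_mixHead n).integrable_comp hf.1).2 hf

theorem integrable_comp_update {f : (ℕ → I) → ℝ} (hf : Integrable f uniformProd)
    (i : ℕ) :
    Integrable (fun z : (ℕ → I) × I => f (Function.update z.1 i z.2))
      (uniformProd.prod volume) :=
  ((measurePreserving_update i).integrable_comp hf.1).2 hf

theorem integral_headAvg_eq {f : (ℕ → I) → ℝ} (hf : Integrable f uniformProd)
    (n : ℕ) : ∫ x, headAvg n f x ∂uniformProd = ∫ x, f x ∂uniformProd := by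
  have h := integral_map (measurePreserving_mixHead n).measurable.aemeasurable
    (f := f) (by rw [(measurePreserving_mixHead n).map_eq]; exact hf.1)
  rw [(measurePreserving_mixHead n).map_eq, integral_prod _ (integrable_comp_mixHead hf n)] at h
  exact h.symm

theorem integral_integral_update {f : (ℕ → I) → ℝ} (hf : Integrable f uniformProd)
    (i : ℕ) :
    ∫ x, (∫ t, f (Function.update x i t)) ∂uniformProd = ∫ x, f x ∂uniformProd := by
  have h := integral_map (measurePreserving_update i).measurable.aemeasurable
    (f := f) (by rw [(measurePreserving_update i).map_eq]; exact hf.1)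
  rw [(measurePreserving_update i).map_eq, integral_prod _ (integrable_comp_update hf i)] at h
  exact h.symm

theorem integrable_headAvg {f : (ℕ → I) → ℝ} (hf : Integrable f uniformProd)
    (n : ℕ) : Integrable (headAvg n f) uniformProd :=
  (integrable_comp_mixHead hf n).integral_prod_left

theorem integrable_slice_ae {f : (ℕ → I) → ℝ} (hf : Integrable f uniformProd)
    (i : ℕ) :
    ∀ᵐ x ∂uniformProd, Integrable fun t => f (Function.update x i t) :=
  (integrable_comp_update hf i).prod_right_ae

theorem integrable_mixHead_ae {f : (ℕ → I) → ℝ} (hf : Integrable f uniformProd)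
    (n : ℕ) :
    ∀ᵐ x ∂uniformProd, Integrable (fun y => f (mixHead n x y)) uniformProd :=
  (integrable_comp_mixHead hf n).prod_right_ae


theorem IsHeadFun.integral_mul {n : ℕ} {f G : (ℕ → I) → ℝ} (hG : IsHeadFun n G)
    (h : Integrable (fun x => f x * G x) uniformProd) :
    ∫ x, headAvg n f x * G x ∂uniformProd = ∫ x, f x * G x ∂uniformProd := by
  rw [← integral_headAvg_eq h n]
  refine integral_congr_ae (Filter.Eventually.of_forall fun x => ?_)
  simp only [headAvg, hG x, integral_mul_const]

/-- Averaging `f` over the coordinates after `n` and then over the `n`-th one. -/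
theorem integral_mixHead_update {n : ℕ} {f : (ℕ → I) → ℝ} {x : ℕ → I}
    (h : Integrable (fun y => f (mixHead n x y)) uniformProd) :
    ∫ y, (∫ t, f (Function.update (mixHead (n + 1) x y) n t)) ∂uniformProd = headAvg n f x := by
  simp only [update_mixHead_succ]
  exact integral_integral_update h n

/-- The tower property in one coordinate, for every `x` with an integrable tail section and not
merely almost everywhere. The tensorisation relies on this pointwise form. -/
theorem integral_headAvg_succ_update {n : ℕ} {f : (ℕ → I) → ℝ} {x : ℕ → I}
    (h : Integrable (fun y => f (mixHead n x y)) uniformProd) :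
    ∫ t, headAvg (n + 1) f (Function.update x n t) = headAvg n f x := by
  rw [← integral_mixHead_update h, integral_integral_swap]
  · simp only [headAvg, mixHead_update_of_lt (Nat.lt_succ_self n)]
  · simp only [update_mixHead_succ]
    exact integrable_comp_update h n

/-- The sigma-algebra generated by the first `n` coordinates. -/
@[reducible] def headSigma (n : ℕ) : MeasurableSpace (ℕ → I) :=
  MeasurableSpace.comap (fun x => mixHead n x 0) inferInstance

theorem measurable_mixHead_left (n : ℕ) (y : ℕ → I) : Measurable fun x => mixHead n x y :=
  (measurable_mixHead n).comp (measurable_id.prodMk measurable_const)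

theorem measurable_mixHead_right (n : ℕ) (x : ℕ → I) : Measurable fun y => mixHead n x y :=
  (measurable_mixHead n).comp (measurable_const.prodMk measurable_id)

theorem headSigma_le (n : ℕ) : headSigma n ≤ (inferInstance : MeasurableSpace (ℕ → I)) :=
  (measurable_mixHead_left n 0).comap_le

theorem headSigma_mono {n m : ℕ} (h : n ≤ m) : headSigma n ≤ headSigma m := by
  rw [headSigma, ← measurable_iff_comap_le]
  have e : (fun x : ℕ → I => mixHead n x 0)
      = (fun x => mixHead n x 0) ∘ fun x => mixHead m x 0 := by
    ext x; simp only [Function.comp, mixHead_mixHead_of_le h]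
  rw [e]
  exact (measurable_mixHead_left n 0).comp (comap_measurable _)

/-- The filtration generated by the coordinates. -/
def headFiltration : Filtration ℕ (inferInstance : MeasurableSpace (ℕ → I)) where
  seq := headSigma
  mono' _ _ h := headSigma_mono h
  le' := headSigma_le

theorem iSup_headSigma : ⨆ n, headSigma n = (inferInstance : MeasurableSpace (ℕ → I)) := by
  refine le_antisymm (iSup_le headSigma_le) ?_
  refine iSup_le fun k => ?_
  refine le_trans ?_ (le_iSup headSigma (k + 1))
  rw [← measurable_iff_comap_le]
  have e : (fun x : ℕ → I => x k) = (fun x => x k) ∘ fun x => mixHead (k + 1) x 0 := by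
    ext x; simp [mixHead]
  rw [e]
  exact (measurable_pi_apply k).comp (comap_measurable _)

/-- Identifies the explicit average with a conditional expectation, which makes `L²` contractivity
and martingale convergence available. -/
theorem headAvg_ae_eq_condExp {f : (ℕ → I) → ℝ} (hm : Measurable f)
    (hf : Integrable f uniformProd) (n : ℕ) :
    headAvg n f =ᵐ[uniformProd] uniformProd[f | headSigma n] := by
  refine ae_eq_condExp_of_forall_setIntegral_eq (headSigma_le n) hf
    (fun s _ _ => (integrable_headAvg hf n).integrableOn) (fun s hs _ => ?_) ?_
  · have hs' := headSigma_le n s hs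
    obtain ⟨T, hT, rfl⟩ := hs
    set s := (fun x => mixHead n x 0) ⁻¹' T with hsdef
    have hG : IsHeadFun n (s.indicator fun _ => (1 : ℝ)) := fun x y => by
      have e : mixHead n x y ∈ s ↔ x ∈ s := by
        simp only [hsdef, mem_preimage, mixHead_mixHead_left]
      by_cases h : x ∈ s
      · rw [indicator_of_mem h, indicator_of_mem (e.2 h)]
      · rw [indicator_of_notMem h, indicator_of_notMem (mt e.1 h)]
    have e : ∀ F : (ℕ → I) → ℝ, s.indicator F = fun x => F x * s.indicator (fun _ => (1 : ℝ)) x := by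
      intro F; ext x; by_cases h : x ∈ s <;> simp [h]
    rw [← integral_indicator hs', ← integral_indicator hs', e, e f]
    refine hG.integral_mul ?_
    rw [← e f]
    exact hf.indicator hs'
  · have e : headAvg n f = headAvg n f ∘ fun x => mixHead n x 0 := by
      ext x; exact ((isHeadFun_headAvg n f) x 0).symm
    have h1 : Measurable[headSigma n] (headAvg n f) := by
      rw [e]
      exact hm.headAvg.comp (comap_measurable _)
    exact h1.stronglyMeasurable.aestronglyMeasurable

theorem memLp_headAvg {f : (ℕ → I) → ℝ} (hm : Measurable f) (hf : MemLp f 2 uniformProd) (n : ℕ) :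
    MemLp (headAvg n f) 2 uniformProd :=
  (memLp_congr_ae (headAvg_ae_eq_condExp hm (hf.integrable (by norm_num)) n)).2
    (hf.condExp (by norm_num))

theorem tendsto_headAvg_ae {f : (ℕ → I) → ℝ} (hm : Measurable f) (hf : Integrable f uniformProd) :
    ∀ᵐ x ∂uniformProd, Filter.Tendsto (fun n => headAvg n f x) Filter.atTop (nhds (f x)) := by
  have h1 : StronglyMeasurable[⨆ n, headFiltration n] f := by
    have : ⨆ n, headFiltration n = (inferInstance : MeasurableSpace (ℕ → I)) := iSup_headSigma
    rw [this]; exact hm.stronglyMeasurable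
  have h2 := hf.tendsto_ae_condExp (ℱ := headFiltration) h1
  have h3 : ∀ᵐ x ∂uniformProd, ∀ n, headAvg n f x = uniformProd[f | headSigma n] x :=
    ae_all_iff.2 fun n => headAvg_ae_eq_condExp hm hf n
  filter_upwards [h2, h3] with x hx hx'
  simp only [hx']
  exact hx

theorem integral_mul_headAvg_of_le {f : (ℕ → I) → ℝ} (hm : Measurable f) (hf : MemLp f 2 uniformProd)
    {n m : ℕ} (h : n ≤ m) :
    ∫ x, headAvg m f x * headAvg n f x ∂uniformProd = ∫ x, headAvg n f x ^ 2 ∂uniformProd := by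
  rw [((isHeadFun_headAvg n f).mono h).integral_mul (hf.integrable_mul (memLp_headAvg hm hf n)),
    ← (isHeadFun_headAvg n f).integral_mul (hf.integrable_mul (memLp_headAvg hm hf n))]
  simp only [sq]

/-- Pythagoras: `headAvg n f` is the orthogonal projection of `headAvg m f` onto functions of the
first `n` coordinates. -/
theorem integral_sq_headAvg_sub {f : (ℕ → I) → ℝ} (hm : Measurable f) (hf : MemLp f 2 uniformProd)
    {n m : ℕ} (h : n ≤ m) :
    ∫ x, (headAvg m f x - headAvg n f x) ^ 2 ∂uniformProd =
      ∫ x, headAvg m f x ^ 2 ∂uniformProd - ∫ x, headAvg n f x ^ 2 ∂uniformProd := by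
  have hn := memLp_headAvg hm hf n
  have hM := memLp_headAvg hm hf m
  have e : ∀ x, (headAvg m f x - headAvg n f x) ^ 2 = headAvg m f x ^ 2
      - 2 * (headAvg m f x * headAvg n f x) + headAvg n f x ^ 2 := fun x => by ring
  have i1 : Integrable (fun x => headAvg m f x * headAvg n f x) uniformProd := hM.integrable_mul hn
  have i2 : Integrable (fun x => headAvg m f x ^ 2 - 2 * (headAvg m f x * headAvg n f x))
    uniformProd := hM.integrable_sq.sub (i1.const_mul 2)
  simp only [e]
  rw [integral_add i2 hn.integrable_sq, integral_sub hM.integrable_sq (i1.const_mul 2),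
    integral_const_mul, integral_mul_headAvg_of_le hm hf h]
  ring

theorem integral_sq_headAvg_le {f : (ℕ → I) → ℝ} (hm : Measurable f) (hf : MemLp f 2 uniformProd)
    (n : ℕ) :
    ∫ x, headAvg n f x ^ 2 ∂uniformProd ≤ ∫ x, f x ^ 2 ∂uniformProd := by
  have hn := memLp_headAvg hm hf n
  have e : ∀ x, (f x - headAvg n f x) ^ 2 = f x ^ 2
      - 2 * (f x * headAvg n f x) + headAvg n f x ^ 2 := fun x => by ring
  have i1 : Integrable (fun x => f x * headAvg n f x) uniformProd := hf.integrable_mul hn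
  have i2 : Integrable (fun x => f x ^ 2 - 2 * (f x * headAvg n f x))
    uniformProd := hf.integrable_sq.sub (i1.const_mul 2)
  have h0 : 0 ≤ ∫ x, (f x - headAvg n f x) ^ 2 ∂uniformProd := integral_nonneg fun x => sq_nonneg _
  have h1 := (isHeadFun_headAvg n f).integral_mul i1
  simp only [← sq] at h1
  simp only [e] at h0
  rw [integral_add i2 hn.integrable_sq, integral_sub hf.integrable_sq (i1.const_mul 2),
    integral_const_mul, ← h1] at h0
  linarith

theorem monotone_integral_sq_headAvg {f : (ℕ → I) → ℝ} (hm : Measurable f) (hf : MemLp f 2 uniformProd)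
    :
    Monotone fun n => ∫ x, headAvg n f x ^ 2 ∂uniformProd := fun n m h => by
  have h1 := integral_sq_headAvg_sub hm hf h
  have h2 : 0 ≤ ∫ x, (headAvg m f x - headAvg n f x) ^ 2 ∂uniformProd :=
    integral_nonneg fun x => sq_nonneg _
  simp only
  linarith

/-- The second moments increase and stay below that of `f`. Almost sure martingale convergence
together with Fatou shows that their limit is not smaller. -/
theorem tendsto_integral_sq_headAvg {f : (ℕ → I) → ℝ} (hm : Measurable f) (hf : MemLp f 2 uniformProd)
    :
    Filter.Tendsto (fun n => ∫ x, headAvg n f x ^ 2 ∂uniformProd) Filter.atTop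
      (nhds (∫ x, f x ^ 2 ∂uniformProd)) := by
  have hbdd : BddAbove (range fun n => ∫ x, headAvg n f x ^ 2 ∂uniformProd) :=
    ⟨_, by rintro _ ⟨n, rfl⟩; exact integral_sq_headAvg_le hm hf n⟩
  have hlim := tendsto_atTop_ciSup (monotone_integral_sq_headAvg hm hf) hbdd
  set l := ⨆ n, ∫ x, headAvg n f x ^ 2 ∂uniformProd with hl
  have hl0 : 0 ≤ l := ge_of_tendsto' hlim fun n => integral_nonneg fun x => sq_nonneg _
  have h1 : ∫ x, f x ^ 2 ∂uniformProd ≤ l := by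
    have hfatou := lintegral_liminf_le (μ := uniformProd) (u := Filter.atTop)
      (f := fun n x => ENNReal.ofReal (headAvg n f x ^ 2))
      fun n => (hm.headAvg.pow_const 2).ennreal_ofReal
    have e1 : ∀ n, ∫⁻ x, ENNReal.ofReal (headAvg n f x ^ 2) ∂uniformProd
        = ENNReal.ofReal (∫ x, headAvg n f x ^ 2 ∂uniformProd) := fun n =>
      (ofReal_integral_eq_lintegral_ofReal (memLp_headAvg hm hf n).integrable_sq
        (Filter.Eventually.of_forall fun x => sq_nonneg _)).symm
    have e2 : ∫⁻ x, Filter.liminf (fun n => ENNReal.ofReal (headAvg n f x ^ 2)) Filter.atTop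
        ∂uniformProd = ENNReal.ofReal (∫ x, f x ^ 2 ∂uniformProd) := by
      rw [ofReal_integral_eq_lintegral_ofReal hf.integrable_sq
        (Filter.Eventually.of_forall fun x => sq_nonneg _)]
      refine lintegral_congr_ae ?_
      filter_upwards [tendsto_headAvg_ae hm (hf.integrable (by norm_num))] with x hx
      exact (ENNReal.tendsto_ofReal (hx.pow 2)).liminf_eq
    simp only [e1, e2] at hfatou
    rw [(ENNReal.tendsto_ofReal hlim).liminf_eq] at hfatou
    exact (ENNReal.ofReal_le_ofReal_iff hl0).1 hfatou
  have h2 : l ≤ ∫ x, f x ^ 2 ∂uniformProd := le_of_tendsto' hlim (integral_sq_headAvg_le hm hf)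
  rwa [le_antisymm h1 h2]

/-! ### Weak partial derivatives and the tensorised inequality -/

/-- `h` is almost everywhere in the remaining coordinates a weak derivative of `f` in the `i`-th
coordinate. -/
def IsTestPartialDeriv (i : ℕ) (f h : (ℕ → I) → ℝ) : Prop :=
  ∀ᵐ x ∂uniformProd,
    IsTestDeriv (fun t => f (Function.update x i t)) fun t => h (Function.update x i t)

theorem memLp_slice_ae {f : (ℕ → I) → ℝ} (hf : MemLp f 2 uniformProd) (i : ℕ) :
    ∀ᵐ x ∂uniformProd, MemLp (fun t => f (Function.update x i t)) 2 := by
  have h1 := integrable_slice_ae hf.integrable_sq i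
  have h2 : ∀ᵐ x ∂uniformProd, AEStronglyMeasurable (fun t => f (Function.update x i t)) volume :=
    (hf.1.comp_measurePreserving (measurePreserving_update i)).prodMk_left
  filter_upwards [h1, h2] with x hx1 hx2
  exact (memLp_two_iff_integrable_sq hx2).2 hx1

theorem isTestDeriv_const (c : ℝ) : IsTestDeriv (fun _ => c) fun _ => 0 := by
  intro g gs gc gt
  have cg : Continuous (deriv g) := gs.continuous_deriv (by simp)
  have h0 : ∀ x, x ∉ Ioo (0 : ℝ) 1 → g x = 0 :=
    fun x hx => image_eq_zero_of_notMem_tsupport fun h => hx (gt h)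
  rw [integral_mul_const, integral_unitInterval_eq (deriv g),
    intervalIntegral.integral_deriv_eq_sub
      (fun x _ => (gs.differentiable (by simp)) x) (cg.intervalIntegrable _ _),
    h0 0 (by simp), h0 1 (by simp)]
  simp

theorem isTestPartialDeriv_headAvg_of_le {i n : ℕ} (h : n ≤ i) (f : (ℕ → I) → ℝ) :
    IsTestPartialDeriv i (headAvg n f) fun _ => 0 := by
  refine Filter.Eventually.of_forall fun x => ?_
  simp only [headAvg, mixHead_update_of_le h]
  exact isTestDeriv_const _

theorem integrable_update_mixHead_ae {f : (ℕ → I) → ℝ} (hf : Integrable f uniformProd) (n i : ℕ) :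
    ∀ᵐ x ∂uniformProd, Integrable
      (fun z : (ℕ → I) × I => f (Function.update (mixHead n x z.1) i z.2))
      (uniformProd.prod volume) := by
  have h1 := ((measurePreserving_mixHead n).prod
    (MeasurePreserving.id (volume : Measure I))).integrable_comp_of_integrable
      (integrable_comp_update hf i)
  have h2 := (measurePreserving_prodAssoc uniformProd uniformProd
    (volume : Measure I)).symm.integrable_comp_of_integrable h1
  exact h2.prod_right_ae

/-- Averaging over the coordinates from `n` on commutes, by Fubini, with testing in a coordinate `i
< n`. -/
theorem IsTestPartialDeriv.headAvg {i n : ℕ} (hin : i < n) {f h : (ℕ → I) → ℝ}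
    (hf : Integrable f uniformProd) (hh : Integrable h uniformProd)
    (hfh : IsTestPartialDeriv i f h) :
    IsTestPartialDeriv i (headAvg n f) (headAvg n h) := by
  have h1 : ∀ᵐ x ∂uniformProd, ∀ᵐ y ∂uniformProd,
      IsTestDeriv (fun t => f (Function.update (mixHead n x y) i t))
        fun t => h (Function.update (mixHead n x y) i t) :=
    Measure.ae_ae_of_ae_prod ((measurePreserving_mixHead n).quasiMeasurePreserving.ae hfh)
  filter_upwards [h1, integrable_update_mixHead_ae hf n i, integrable_update_mixHead_ae hh n i]
    with x hx hxf hxh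
  intro g gs gc gt
  have swap : ∀ {G : ℝ → ℝ} {F : (ℕ → I) → ℝ}, Continuous G → Integrable
      (fun z : (ℕ → I) × I => F (Function.update (mixHead n x z.1) i z.2))
        (uniformProd.prod volume) →
      ∫ t : I, G t * _root_.headAvg n F (Function.update x i t) =
        ∫ y, (∫ t : I, G t * F (Function.update (mixHead n x y) i t)) ∂uniformProd := by
    intro G F hG hF
    obtain ⟨C, hC⟩ := isCompact_univ.exists_bound_of_continuousOn
      (f := fun t : I => G t) (by fun_prop)
    have hi : Integrable (fun z : (ℕ → I) × I =>
        G z.2 * F (Function.update (mixHead n x z.1) i z.2)) (uniformProd.prod volume) :=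
      hF.bdd_mul (c := C) (Continuous.aestronglyMeasurable (by fun_prop))
        (Filter.Eventually.of_forall fun z => hC z.2 (mem_univ _))
    rw [integral_integral_swap hi]
    simp only [_root_.headAvg, mixHead_update_of_lt hin, integral_const_mul]
  rw [swap (gs.continuous_deriv (by simp)) hxf, swap gs.continuous hxh, ← integral_neg]
  exact integral_congr_ae (hx.mono fun y hy => hy g gs gc gt)

theorem IsTestPartialDeriv.sub {i : ℕ} {f f' h h' : (ℕ → I) → ℝ}
    (if1 : Integrable f uniformProd) (if2 : Integrable f' uniformProd)
    (ih1 : Integrable h uniformProd) (ih2 : Integrable h' uniformProd)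
    (h1 : IsTestPartialDeriv i f f') (h2 : IsTestPartialDeriv i h h') :
    IsTestPartialDeriv i (fun x => f x - h x) (fun x => f' x - h' x) := by
  filter_upwards [h1, h2, integrable_slice_ae if1 i, integrable_slice_ae if2 i,
    integrable_slice_ae ih1 i, integrable_slice_ae ih2 i] with x a1 a2 a3 a4 a5 a6
  exact a1.sub a3 a4 a5 a6 a2

/-- The dual logarithmic Sobolev inequality in a single coordinate of the infinite product. -/
theorem IsTestPartialDeriv.dual_logSobolev {i : ℕ} {g w h : (ℕ → I) → ℝ}
    (hg : MemLp g 2 uniformProd) (hw : MemLp w 2 uniformProd) (hgw : IsTestPartialDeriv i g w)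
    (hm : Measurable h) {C : ℝ} (hb : ∀ x, |h x| ≤ C)
    (hexp : ∀ x, ∫ t, Real.exp (h (Function.update x i t)) ≤ 1) :
    ∫ x, g x ^ 2 * h x ∂uniformProd ≤ 2 / Real.pi ^ 2 * ∫ x, w x ^ 2 ∂uniformProd := by
  have hgh : Integrable (fun x => g x ^ 2 * h x) uniformProd :=
    hg.integrable_sq.mul_bdd (c := C) hm.aestronglyMeasurable (Filter.Eventually.of_forall hb)
  rw [← integral_integral_update hgh i, ← integral_integral_update hw.integrable_sq i,
    ← integral_const_mul]
  refine integral_mono_ae (integrable_comp_update hgh i).integral_prod_left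
    ((integrable_comp_update hw.integrable_sq i).integral_prod_left.const_mul _) ?_
  filter_upwards [hgw, memLp_slice_ae hg i, memLp_slice_ae hw i] with x h1 h2 h3
  exact h1.dual_logSobolev h2 h3 (hm.comp (measurable_update x)) (fun t => hb _) (hexp x)

/-- The dual logarithmic Sobolev inequality on the product space, tested against functions of the
first `n` coordinates. -/
theorem dual_logSobolev_prod {n : ℕ} {g h : (ℕ → I) → ℝ} {w : ℕ → (ℕ → I) → ℝ}
    (hg : MemLp g 2 uniformProd) (hw : ∀ i < n, MemLp (w i) 2 uniformProd)
    (hgw : ∀ i < n, IsTestPartialDeriv i g (w i)) (hm : Measurable h) {C : ℝ}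
    (hb : ∀ x, |h x| ≤ C) (hhead : IsHeadFun n h) (hexp : ∫ x, Real.exp (h x) ∂uniformProd ≤ 1) :
    ∫ x, g x ^ 2 * h x ∂uniformProd ≤
      2 / Real.pi ^ 2 * ∑ i ∈ Finset.range n, ∫ x, w i x ^ 2 ∂uniformProd := by
  set E : (ℕ → I) → ℝ := fun x => Real.exp (h x) with hE
  have mE : Measurable E := hm.exp
  have lE : ∀ x, Real.exp (-C) ≤ E x := fun x => Real.exp_le_exp.2 (abs_le.1 (hb x)).1
  have uE : ∀ x, E x ≤ Real.exp C := fun x => Real.exp_le_exp.2 (abs_le.1 (hb x)).2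
  have iEs : ∀ k x, Integrable (fun y => E (mixHead k x y)) uniformProd := fun k x =>
    Integrable.of_bound (mE.comp (measurable_mixHead_right k x)).aestronglyMeasurable (Real.exp C)
      (Filter.Eventually.of_forall fun y => by
        rw [Real.norm_eq_abs, abs_of_pos (Real.exp_pos _)]; exact uE _)
  -- The martingale of `exp h`. Since `H k` is the average of `H (k + 1)` over coordinate `k`, the
  -- increment `L k` of `log H` satisfies `∫ exp (L k) dx_k = 1`, so it is admissible in the
  -- one-coordinate inequality.
  set H : ℕ → (ℕ → I) → ℝ := fun k => headAvg k E with hH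
  have lH : ∀ k x, Real.exp (-C) ≤ H k x := fun k x => by
    calc Real.exp (-C) = ∫ _, Real.exp (-C) ∂uniformProd := by simp
      _ ≤ _ := integral_mono (integrable_const _) (iEs k x) fun y => lE _
  have uH : ∀ k x, H k x ≤ Real.exp C := fun k x => by
    calc H k x ≤ ∫ _, Real.exp C ∂uniformProd :=
          integral_mono (iEs k x) (integrable_const _) fun y => uE _
      _ = Real.exp C := by simp
  have pH : ∀ k x, 0 < H k x := fun k x => (Real.exp_pos _).trans_le (lH k x)
  have mH : ∀ k, Measurable (H k) := fun k => mE.headAvg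
  have bL : ∀ k x, |Real.log (H k x)| ≤ C := fun k x => by
    rw [abs_le]
    exact ⟨(Real.le_log_iff_exp_le (pH k x)).2 (lH k x), (Real.log_le_iff_le_exp (pH k x)).2 (uH k x)⟩
  set L : ℕ → (ℕ → I) → ℝ := fun k x => Real.log (H (k + 1) x) - Real.log (H k x) with hL
  have mL : ∀ k, Measurable (L k) := fun k => (mH (k + 1)).log.sub (mH k).log
  have bLk : ∀ k x, |L k x| ≤ C + C := fun k x =>
    (abs_sub _ _).trans (add_le_add (bL _ _) (bL _ _))
  have eL : ∀ k x, ∫ t, Real.exp (L k (Function.update x k t)) ≤ 1 := fun k x => by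
    have e1 : ∀ t, Real.exp (L k (Function.update x k t))
        = H (k + 1) (Function.update x k t) / H k x := fun t => by
      have e2 : H k (Function.update x k t) = H k x := by
        simp only [hH, headAvg, mixHead_update_of_le le_rfl]
      simp only [hL]
      rw [Real.exp_sub, Real.exp_log (pH _ _), Real.exp_log (pH _ _), e2]
    simp only [e1]
    rw [integral_div, hH, integral_headAvg_succ_update (iEs k x)]
    exact (div_self (pH k x).ne').le
  -- The sum telescopes; `H n = exp h` because `h` depends on the first `n` coordinates only, and
  -- `log (H 0) ≤ 0` is the normalisation of `h`.
  have hsum : ∀ x, h x = ∑ k ∈ Finset.range n, L k x + Real.log (H 0 x) := fun x => by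
    rw [Finset.sum_range_sub (fun k => Real.log (H k x))]
    have e1 : IsHeadFun n E := fun x y => by simp only [hE, hhead x y]
    have e2 : H n = E := e1.headAvg_eq
    rw [e2]
    simp [hE]
  have h0 : ∀ x, Real.log (H 0 x) ≤ 0 := fun x => by
    refine Real.log_nonpos (pH 0 x).le ?_
    exact (headAvg_zero E x).trans_le hexp
  have iL : ∀ k, Integrable (fun x => g x ^ 2 * L k x) uniformProd := fun k =>
    hg.integrable_sq.mul_bdd (c := C + C) (mL k).aestronglyMeasurable
      (Filter.Eventually.of_forall (bLk k))
  calc ∫ x, g x ^ 2 * h x ∂uniformProd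
      ≤ ∫ x, ∑ k ∈ Finset.range n, g x ^ 2 * L k x ∂uniformProd := by
        refine integral_mono (hg.integrable_sq.mul_bdd (c := C) hm.aestronglyMeasurable
          (Filter.Eventually.of_forall hb)) (integrable_finsetSum _ fun k _ => iL k) fun x => ?_
        simp only
        rw [← Finset.mul_sum]
        refine mul_le_mul_of_nonneg_left ?_ (sq_nonneg _)
        linarith [hsum x, h0 x]
    _ = ∑ k ∈ Finset.range n, ∫ x, g x ^ 2 * L k x ∂uniformProd :=
        integral_finsetSum _ fun k _ => iL k
    _ ≤ ∑ k ∈ Finset.range n, 2 / Real.pi ^ 2 * ∫ x, w k x ^ 2 ∂uniformProd :=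
        Finset.sum_le_sum fun k hk => (hgw k (Finset.mem_range.1 hk)).dual_logSobolev hg
          (hw k (Finset.mem_range.1 hk)) (mL k) (bLk k) (eL k)
    _ = _ := by rw [Finset.mul_sum]

/-! ### The inequality for a function of finitely many coordinates -/

theorem integrable_abs_of_memLp {g : (ℕ → I) → ℝ} (hg : MemLp g 2 uniformProd) :
    Integrable (fun x => |g x|) uniformProd :=
  (hg.integrable (by norm_num)).abs

/-- A lower bound for the entropy of `g ^ 2` by its first and second absolute moments, combined with
the logarithmic Sobolev inequality. -/
theorem moment_logSobolev {n : ℕ} {g : (ℕ → I) → ℝ} {w : ℕ → (ℕ → I) → ℝ} (hgm : Measurable g)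
    (hg : MemLp g 2 uniformProd) (hw : ∀ i < n, MemLp (w i) 2 uniformProd)
    (hgw : ∀ i < n, IsTestPartialDeriv i g (w i)) (hhead : IsHeadFun n g) {θ : ℝ} (hθ : 0 < θ) :
    (∫ x, g x ^ 2 ∂uniformProd) * Real.log θ + (∫ x, g x ^ 2 ∂uniformProd)
      - θ * (∫ x, |g x| ∂uniformProd) ^ 2 ≤
      2 / Real.pi ^ 2 * ∑ i ∈ Finset.range n, ∫ x, w i x ^ 2 ∂uniformProd := by
  have ig2 := hg.integrable_sq
  have ig1 := integrable_abs_of_memLp hg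
  set A := ∫ x, g x ^ 2 ∂uniformProd with hA
  set b := ∫ x, |g x| ∂uniformProd with hb
  set R := 2 / Real.pi ^ 2 * ∑ i ∈ Finset.range n, ∫ x, w i x ^ 2 ∂uniformProd with hR
  have hA0 : 0 ≤ A := integral_nonneg fun x => sq_nonneg _
  have hb0 : 0 ≤ b := integral_nonneg fun x => abs_nonneg _
  have hR0 : 0 ≤ R := mul_nonneg (by positivity)
    (Finset.sum_nonneg fun i _ => integral_nonneg fun x => sq_nonneg _)
  rcases hA0.eq_or_lt with hA1 | hA1
  · rw [← hA1]
    have : 0 ≤ θ * b ^ 2 := by positivity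
    linarith
  -- The ideal test function is `log (g² / ∫ g²)`. To have it bounded, `|g|` is truncated at `1/ε`
  -- and shifted by `ε`, and `c` is an upper bound for `∫ v²`. The tangent bound `log v ≥ log a + 1
  -- - a/v` together with `g²/v ≤ |g| + ε g²` leaves only the first and second absolute moments.
  have key : ∀ a : ℝ, 0 < a → ∀ ε : ℝ, 0 < ε →
      2 * (A * (Real.log a + 1) - a * (b + A * ε)) - A * Real.log (A + 2 * ε * b + ε ^ 2) ≤ R := by
    intro a ha ε hε
    set v : (ℕ → I) → ℝ := fun x => min |g x| ε⁻¹ + ε with hv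
    have mv : Measurable v := by
      have : Measurable fun x => |g x| := hgm.abs
      exact (this.min measurable_const).add_const _
    have v1 : ∀ x, ε ≤ v x := fun x => by
      have : 0 ≤ min |g x| ε⁻¹ := le_min (abs_nonneg _) (by positivity)
      simp only [hv]; linarith
    have v2 : ∀ x, v x ≤ ε⁻¹ + ε := fun x => by
      have := min_le_right |g x| ε⁻¹
      simp only [hv]; linarith
    have v3 : ∀ x, v x ≤ |g x| + ε := fun x => by
      have := min_le_left |g x| ε⁻¹
      simp only [hv]; linarith
    have pv : ∀ x, 0 < v x := fun x => hε.trans_le (v1 x)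
    set c := A + 2 * ε * b + ε ^ 2 with hc
    have hc0 : 0 < c := by positivity
    have bl : ∀ x, |Real.log (v x)| ≤ |Real.log ε| + |Real.log (ε⁻¹ + ε)| := fun x => by
      have l1 := Real.log_le_log hε (v1 x)
      have l2 := Real.log_le_log (pv x) (v2 x)
      rw [abs_le]
      constructor
      · linarith [neg_abs_le (Real.log ε), abs_nonneg (Real.log (ε⁻¹ + ε))]
      · linarith [le_abs_self (Real.log (ε⁻¹ + ε)), abs_nonneg (Real.log ε)]
    have hdual := dual_logSobolev_prod (h := fun x => 2 * Real.log (v x) - Real.log c) hg hw hgw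
      ((mv.log.const_mul 2).sub_const _)
      (C := 2 * (|Real.log ε| + |Real.log (ε⁻¹ + ε)|) + |Real.log c|)
      (fun x => by
        refine (abs_sub _ _).trans (add_le_add ?_ le_rfl)
        rw [abs_mul, abs_two]
        exact mul_le_mul_of_nonneg_left (bl x) zero_le_two)
      (fun x y => by simp only [hv, hhead x y]) ?_
    · refine le_trans ?_ hdual
      have low : ∀ x, 2 * (g x ^ 2 * (Real.log a + 1) - a * (|g x| + g x ^ 2 * ε))
          - g x ^ 2 * Real.log c ≤ g x ^ 2 * (2 * Real.log (v x) - Real.log c) := fun x => by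
        have h1 : Real.log a + 1 - a / v x ≤ Real.log (v x) := by
          have := Real.log_le_sub_one_of_pos (div_pos ha (pv x))
          rw [Real.log_div ha.ne' (pv x).ne'] at this
          linarith
        have h2 : g x ^ 2 / v x ≤ |g x| + g x ^ 2 * ε := by
          rw [div_le_iff₀ (pv x)]
          rcases le_total |g x| ε⁻¹ with h | h
          · have e : v x = |g x| + ε := by simp only [hv, min_eq_left h]
            have h3 : 0 ≤ |g x| * ε := by positivity
            have h4 : 0 ≤ g x ^ 2 * ε * v x := by have := pv x; positivity
            rw [← sq_abs] at h4 ⊢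
            rw [e] at h4 ⊢
            nlinarith
          · have e : v x = ε⁻¹ + ε := by simp only [hv, min_eq_right h]
            have h3 : g x ^ 2 * ε * v x = g x ^ 2 + g x ^ 2 * ε ^ 2 := by
              rw [e]; field_simp
            have h4 : 0 ≤ |g x| * v x := mul_nonneg (abs_nonneg _) (pv x).le
            have h5 : 0 ≤ g x ^ 2 * ε ^ 2 := by positivity
            nlinarith
        have h3 := mul_le_mul_of_nonneg_left h1 (sq_nonneg (g x))
        have h4 := mul_le_mul_of_nonneg_left h2 ha.le
        have h5 : g x ^ 2 * (Real.log a + 1 - a / v x)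
          = g x ^ 2 * (Real.log a + 1) - a * (g x ^ 2 / v x) := by ring
        nlinarith
      have i1 : Integrable (fun x => |g x| + g x ^ 2 * ε) uniformProd := ig1.add (ig2.mul_const ε)
      have i2 : Integrable (fun x => g x ^ 2 * (Real.log a + 1) - a * (|g x| + g x ^ 2 * ε))
        uniformProd := (ig2.mul_const _).sub (i1.const_mul a)
      have hint := integral_mono ((i2.const_mul 2).sub (ig2.mul_const (Real.log c)))
        (ig2.mul_bdd (c := 2 * (|Real.log ε| + |Real.log (ε⁻¹ + ε)|) + |Real.log c|)
          ((mv.log.const_mul 2).sub_const (Real.log c)).aestronglyMeasurable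
          (Filter.Eventually.of_forall fun x => by
            rw [Real.norm_eq_abs]
            refine (abs_sub _ _).trans (add_le_add ?_ le_rfl)
            rw [abs_mul, abs_two]
            exact mul_le_mul_of_nonneg_left (bl x) zero_le_two)) low
      refine le_trans (le_of_eq ?_) hint
      simp only [Pi.sub_apply]
      rw [integral_sub (i2.const_mul 2) (ig2.mul_const _), integral_const_mul,
        integral_sub (ig2.mul_const _) (i1.const_mul a), integral_mul_const, integral_const_mul,
        integral_add ig1 (ig2.mul_const ε), integral_mul_const, integral_mul_const]
    · have e1 : ∀ x, Real.exp (2 * Real.log (v x) - Real.log c) = v x ^ 2 / c := fun x => by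
        rw [Real.exp_sub, Real.exp_log hc0, two_mul, Real.exp_add, Real.exp_log (pv x), sq]
      simp only [e1]
      rw [integral_div, div_le_one hc0]
      have i1 : Integrable (fun x => g x ^ 2 + 2 * ε * |g x|) uniformProd :=
        ig2.add (ig1.const_mul _)
      calc ∫ x, v x ^ 2 ∂uniformProd ≤ ∫ x, (g x ^ 2 + 2 * ε * |g x| + ε ^ 2) ∂uniformProd := by
            refine integral_mono_of_nonneg (Filter.Eventually.of_forall fun x => sq_nonneg _)
              (i1.add (integrable_const _)) (Filter.Eventually.of_forall fun x => ?_)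
            have := pow_le_pow_left₀ (pv x).le (v3 x) 2
            simp only
            rw [← sq_abs (g x)]
            nlinarith
        _ = c := by
            rw [integral_add i1 (integrable_const _), integral_add ig2 (ig1.const_mul _),
              integral_const_mul]
            simp [hc, hA, hb]
  have key2 : ∀ a : ℝ, 0 < a → 2 * (A * (Real.log a + 1) - a * b) - A * Real.log A ≤ R := by
    intro a ha
    have hcont : ContinuousAt (fun ε : ℝ => 2 * (A * (Real.log a + 1) - a * (b + A * ε))
        - A * Real.log (A + 2 * ε * b + ε ^ 2)) 0 := by
      refine ContinuousAt.sub (by fun_prop) (continuousAt_const.mul (ContinuousAt.log (by fun_prop) ?_))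
      simpa using hA1.ne'
    have hlim := hcont.tendsto.mono_left (nhdsWithin_le_nhds (s := Ioi 0))
    refine le_trans (le_of_eq (by simp)) (le_of_tendsto hlim
      (Filter.eventually_of_mem self_mem_nhdsWithin (key a ha)))
  -- Taking `a = √(Aθ)` gives `2 log a = log A + log θ` and, by the arithmetic-geometric mean
  -- inequality, `2ab ≤ A + θb²`. This produces a bound affine in `A` and `b²`, which can be summed.
  set s := Real.sqrt (A * θ) with hs
  have hAθ : 0 < A * θ := by positivity
  have hs0 : 0 < s := Real.sqrt_pos.2 hAθ
  have h1 := key2 s hs0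
  have h2 : 2 * Real.log s = Real.log A + Real.log θ := by
    rw [hs, Real.log_sqrt hAθ.le, Real.log_mul hA1.ne' hθ.ne']; ring
  have h3 : 2 * s * b ≤ A + θ * b ^ 2 := by
    have h4 : s = Real.sqrt A * Real.sqrt θ := Real.sqrt_mul hA0 θ
    have h5 := Real.sq_sqrt hA0
    have h6 := Real.sq_sqrt hθ.le
    rw [h4]
    nlinarith [sq_nonneg (Real.sqrt A - Real.sqrt θ * b)]
  have h4 : 2 * (A * (Real.log s + 1) - s * b) - A * Real.log A
      = A * (2 * Real.log s) - A * Real.log A + 2 * A - 2 * s * b := by ring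
  rw [h4, h2] at h1
  linarith

/-- The martingale differences are averages of `coordDelta`. -/
theorem integral_abs_headAvg_succ_sub_le {f : (ℕ → I) → ℝ} (hf : Integrable f uniformProd) (j : ℕ) :
    ∫ x, |headAvg (j + 1) f x - headAvg j f x| ∂uniformProd ≤
      ∫ x, |coordDelta j f x| ∂uniformProd := by
  have iQ : Integrable (fun x => ∫ t, f (Function.update x j t)) uniformProd :=
    (integrable_comp_update hf j).integral_prod_left
  have iΔ : Integrable (coordDelta j f) uniformProd := hf.sub iQ
  rw [← integral_headAvg_eq iΔ.abs (j + 1)]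
  refine integral_mono_ae ((integrable_headAvg hf _).sub (integrable_headAvg hf _)).abs
    (integrable_headAvg iΔ.abs _) ?_
  filter_upwards [integrable_mixHead_ae hf j, integrable_mixHead_ae hf (j + 1),
    integrable_mixHead_ae iQ (j + 1)] with x h1 h2 h3
  have e : headAvg (j + 1) f x - headAvg j f x = ∫ y, coordDelta j f (mixHead (j + 1) x y)
      ∂uniformProd := by
    simp only [coordDelta]
    rw [integral_sub h2 h3, integral_mixHead_update h1]
    rfl
  rw [e]
  exact norm_integral_le_integral_norm fun y => coordDelta j f (mixHead (j + 1) x y)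

/-- Sums the moment inequality over the martingale differences with one common `θ`. All three kinds
of terms are then additive, and the two families of second moments telescope. -/
theorem logSobolev_headAvg {f : (ℕ → I) → ℝ} {df : ℕ → (ℕ → I) → ℝ} (hm : Measurable f)
    (hf : MemLp f 2 uniformProd) (hdm : ∀ i, Measurable (df i))
    (hdf2 : ∀ i, MemLp (df i) 2 uniformProd) (hdf : ∀ i, IsTestPartialDeriv i f (df i))
    (n : ℕ) {θ : ℝ} (hθ : 0 < θ) :
    (∫ x, headAvg n f x ^ 2 ∂uniformProd - ∫ x, headAvg 0 f x ^ 2 ∂uniformProd) * Real.log θ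
      + (∫ x, headAvg n f x ^ 2 ∂uniformProd - ∫ x, headAvg 0 f x ^ 2 ∂uniformProd)
      - θ * ∑ j ∈ Finset.range n, (∫ x, |coordDelta j f x| ∂uniformProd) ^ 2 ≤
      2 / Real.pi ^ 2 * ∑ i ∈ Finset.range n, ∫ x, df i x ^ 2 ∂uniformProd := by
  have hfi : Integrable f uniformProd := hf.integrable (by norm_num)
  have hdi : ∀ i, Integrable (df i) uniformProd := fun i => (hdf2 i).integrable (by norm_num)
  set N : ℕ → ℝ := fun n => ∫ x, headAvg n f x ^ 2 ∂uniformProd with hN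
  -- The squared norm of the `i`-th partial derivative of `headAvg j f`: this derivative is the
  -- average of `df i` when `i < j`, and zero otherwise.
  set c : ℕ → ℕ → ℝ := fun i j => if i < j then ∫ x, headAvg j (df i) x ^ 2 ∂uniformProd else 0
    with hc
  have step : ∀ j, (N (j + 1) - N j) * Real.log θ + (N (j + 1) - N j)
      - θ * (∫ x, |coordDelta j f x| ∂uniformProd) ^ 2 ≤
      2 / Real.pi ^ 2 * ∑ i ∈ Finset.range (j + 1), (c i (j + 1) - c i j) := by
    intro j
    set w : ℕ → (ℕ → I) → ℝ := fun i x => headAvg (j + 1) (df i) x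
      - if i < j then headAvg j (df i) x else 0 with hw
    have hwL : ∀ i < j + 1, MemLp (w i) 2 uniformProd := fun i _ => by
      simp only [hw]
      split_ifs
      · exact (memLp_headAvg (hdm i) (hdf2 i) _).sub (memLp_headAvg (hdm i) (hdf2 i) _)
      · simpa using memLp_headAvg (hdm i) (hdf2 i) (j + 1)
    have hwD : ∀ i < j + 1, IsTestPartialDeriv i
        (fun x => headAvg (j + 1) f x - headAvg j f x) (w i) := fun i hi => by
      have h1 := (hdf i).headAvg hi hfi (hdi i)
      simp only [hw]
      split_ifs with hij
      · exact h1.sub (integrable_headAvg hfi _) (integrable_headAvg (hdi i) _)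
          (integrable_headAvg hfi _) (integrable_headAvg (hdi i) _)
          ((hdf i).headAvg hij hfi (hdi i))
      · exact h1.sub (integrable_headAvg hfi _) (integrable_headAvg (hdi i) _)
          (integrable_headAvg hfi _) (integrable_const 0)
          (isTestPartialDeriv_headAvg_of_le (not_lt.1 hij) f)
    have hwI : ∀ i ∈ Finset.range (j + 1), ∫ x, w i x ^ 2 ∂uniformProd = c i (j + 1) - c i j := by
      intro i hi
      have hi' := Finset.mem_range.1 hi
      simp only [hw, hc, if_pos hi']
      split_ifs with hij
      · exact integral_sq_headAvg_sub (hdm i) (hdf2 i) (Nat.le_succ j)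
      · simp
    have hsq := integral_sq_headAvg_sub hm hf (Nat.le_succ j)
    have hmain := moment_logSobolev (n := j + 1) (hm.headAvg.sub hm.headAvg)
      ((memLp_headAvg hm hf (j + 1)).sub (memLp_headAvg hm hf j)) hwL hwD
      (fun x y => by
        simp only [Pi.sub_apply]
        rw [isHeadFun_headAvg (j + 1) f x y, (isHeadFun_headAvg j f).mono (Nat.le_succ j) x y]) hθ
    simp only [Pi.sub_apply] at hmain
    rw [Finset.sum_congr rfl hwI] at hmain
    simp only [Nat.succ_eq_add_one] at hsq
    rw [hsq] at hmain
    have h1 := pow_le_pow_left₀ (integral_nonneg fun x => abs_nonneg _)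
      (integral_abs_headAvg_succ_sub_le hfi j) 2
    have h2 := mul_le_mul_of_nonneg_left h1 hθ.le
    simp only [hN]
    linarith
  have hsum := Finset.sum_le_sum fun j (_ : j ∈ Finset.range n) => step j
  rw [Finset.sum_sub_distrib, Finset.sum_add_distrib, ← Finset.sum_mul, ← Finset.mul_sum,
    ← Finset.mul_sum, Finset.sum_range_sub] at hsum
  refine hsum.trans (mul_le_mul_of_nonneg_left ?_ (by positivity))
  -- Terms with `i > j` vanish, so the triangular sum extends to a square one; after exchanging the
  -- sums, each row telescopes to `c i n`.
  have hext : ∀ j ∈ Finset.range n, ∑ i ∈ Finset.range (j + 1), (c i (j + 1) - c i j)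
      = ∑ i ∈ Finset.range n, (c i (j + 1) - c i j) := fun j hj => by
    refine Finset.sum_subset (Finset.range_mono (Finset.mem_range.1 hj)) fun i _ hi => ?_
    have h1 : ¬ i < j + 1 := fun h => hi (Finset.mem_range.2 h)
    have h2 : ¬ i < j := fun h => h1 (h.trans (Nat.lt_succ_self j))
    simp only [hc, if_neg h1, if_neg h2, sub_zero]
  rw [Finset.sum_congr rfl hext, Finset.sum_comm]
  refine Finset.sum_le_sum fun i hi => ?_
  rw [Finset.sum_range_sub (fun j => c i j)]
  simp only [hc, if_pos (Finset.mem_range.1 hi), Nat.not_lt_zero, if_false, sub_zero]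
  exact integral_sq_headAvg_le (hdm i) (hdf2 i) n

/-! ### The inequality on the infinite product -/

theorem slice_ae_eq {f g : (ℕ → I) → ℝ} (h : f =ᵐ[uniformProd] g) (i : ℕ) :
    ∀ᵐ x ∂uniformProd, (fun t => f (Function.update x i t)) =ᵐ[volume]
      fun t => g (Function.update x i t) :=
  Measure.ae_ae_of_ae_prod ((measurePreserving_update i).quasiMeasurePreserving.ae h)

/-- Almost every line meets a null set in a null set, so `f` and its derivative may be replaced by
measurable representatives. -/
theorem HasWeakPartialDeriv.isTestPartialDeriv {i : ℕ} {f f' h h' : (ℕ → I) → ℝ}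
    (hfh : HasWeakPartialDeriv i f h) (hf : f =ᵐ[uniformProd] f') (hh : h =ᵐ[uniformProd] h') :
    IsTestPartialDeriv i f' h' := by
  filter_upwards [hfh, slice_ae_eq hf i, slice_ae_eq hh i] with x hx h1 h2
  intro g gs gc gt
  have e1 : ∫ t : I, deriv g t * f' (Function.update x i t)
      = ∫ t : I, deriv g t * f (Function.update x i t) :=
    integral_congr_ae (h1.mono fun t ht => by simp only [ht])
  have e2 : ∫ t : I, g t * h' (Function.update x i t)
      = ∫ t : I, g t * h (Function.update x i t) :=
    integral_congr_ae (h2.mono fun t ht => by simp only [ht])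
  rw [e1, e2]
  exact hx.2.2 g gs gc gt

theorem coordDelta_congr_ae {f g : (ℕ → I) → ℝ} (h : f =ᵐ[uniformProd] g) (i : ℕ) :
    coordDelta i f =ᵐ[uniformProd] coordDelta i g := by
  filter_upwards [h, slice_ae_eq h i] with x hx h1
  simp only [coordDelta, hx, integral_congr_ae h1]

theorem integrable_coordDelta {f : (ℕ → I) → ℝ} (hf : Integrable f uniformProd) (i : ℕ) :
    Integrable (coordDelta i f) uniformProd :=
  hf.sub (integrable_comp_update hf i).integral_prod_left

/-- A linearised form of the main inequality, for measurable functions. -/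
theorem variance_logSobolev {f : (ℕ → I) → ℝ} {df : ℕ → (ℕ → I) → ℝ} (hm : Measurable f)
    (hf : MemLp f 2 uniformProd) (hdm : ∀ i, Measurable (df i))
    (hdf2 : ∀ i, MemLp (df i) 2 uniformProd) (hdf : ∀ i, IsTestPartialDeriv i f (df i)) {s d : ℝ}
    (hs : ∀ n, ∑ j ∈ Finset.range n, (∫ x, |coordDelta j f x| ∂uniformProd) ^ 2 ≤ s)
    (hd : ∀ n, ∑ i ∈ Finset.range n, ∫ x, df i x ^ 2 ∂uniformProd ≤ d) {θ : ℝ} (hθ : 0 < θ) :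
    variance f uniformProd * Real.log θ + variance f uniformProd - θ * s ≤
      2 / Real.pi ^ 2 * d := by
  have hN := tendsto_integral_sq_headAvg hm hf
  have h0 : ∫ x, headAvg 0 f x ^ 2 ∂uniformProd = (∫ x, f x ∂uniformProd) ^ 2 := by
    simp [headAvg_zero]
  have hv : Filter.Tendsto (fun n => ∫ x, headAvg n f x ^ 2 ∂uniformProd
      - ∫ x, headAvg 0 f x ^ 2 ∂uniformProd) Filter.atTop (nhds (variance f uniformProd)) := by
    rw [variance_eq_sub hf, h0]
    exact hN.sub_const _
  refine le_of_tendsto' (((hv.mul_const (Real.log θ)).add hv).sub_const (θ * s)) fun n => ?_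
  have h1 := logSobolev_headAvg hm hf hdm hdf2 hdf n hθ
  have h2 := mul_le_mul_of_nonneg_left (hs n) hθ.le
  have h3 : 2 / Real.pi ^ 2 * ∑ i ∈ Finset.range n, ∫ x, df i x ^ 2 ∂uniformProd ≤
      2 / Real.pi ^ 2 * d := mul_le_mul_of_nonneg_left (hd n) (by positivity)
  linarith

theorem sum_le_toReal_tsum {a : ℕ → ℝ} {b : ℕ → ℝ≥0∞} (hb : ∀ i, b i = ENNReal.ofReal (a i))
    (ha : ∀ i, 0 ≤ a i) (h : ∑' i, b i ≠ ⊤) (n : ℕ) :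
    ∑ i ∈ Finset.range n, a i ≤ (∑' i, b i).toReal := by
  rw [← ENNReal.ofReal_le_iff_le_toReal h, ENNReal.ofReal_sum_of_nonneg fun i _ => ha i]
  simp only [← hb]
  exact ENNReal.sum_le_tsum _

theorem mainTheorem8 (f : (ℕ → I) → ℝ) (hf : MemLp f 2 uniformProd)
    (df : ℕ → (ℕ → I) → ℝ) (hdf : ∀ i, HasWeakPartialDeriv i f (df i))
    (hdf2 : ∀ i, MemLp (df i) 2 uniformProd) :
    ((evariance f uniformProd : ℝ≥0∞) : EReal) *
        ENNReal.log
          (evariance f uniformProd / ∑' i : ℕ, eLpNorm (coordDelta i f) 1 uniformProd ^ 2) ≤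
      ((ENNReal.ofReal (2 / Real.pi ^ 2) *
          ∑' i : ℕ, ∫⁻ x, ENNReal.ofReal (df i x ^ 2) ∂uniformProd : ℝ≥0∞) : EReal) := by
  set S := ∑' i : ℕ, eLpNorm (coordDelta i f) 1 uniformProd ^ 2 with hS
  set D := ∑' i : ℕ, ∫⁻ x, ENNReal.ofReal (df i x ^ 2) ∂uniformProd with hD
  have hK : (0 : ℝ) < 2 / Real.pi ^ 2 := by positivity
  by_cases hDtop : D = ⊤
  · rw [hDtop, ENNReal.mul_top (ENNReal.ofReal_pos.2 hK).ne']
    exact le_top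
  by_cases hV0 : evariance f uniformProd = 0
  · rw [hV0, EReal.coe_ennreal_zero, zero_mul]
    exact EReal.coe_ennreal_nonneg _
  have hVtop : evariance f uniformProd ≠ ⊤ := (evariance_lt_top hf).ne
  -- Here the quotient is `0`, its logarithm is `⊥`, and a positive variance makes the left-hand
  -- side `⊥`.
  by_cases hStop : S = ⊤
  · rw [hStop, ENNReal.div_top, ENNReal.log_zero, EReal.mul_bot_of_pos]
    · exact bot_le
    · simpa using pos_iff_ne_zero.2 hV0
  set f' := hf.1.mk f with hf'
  have hff' : f =ᵐ[uniformProd] f' := hf.1.ae_eq_mk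
  have hfm : Measurable f' := hf.1.stronglyMeasurable_mk.measurable
  have hf2 : MemLp f' 2 uniformProd := (memLp_congr_ae hff').1 hf
  set df' : ℕ → (ℕ → I) → ℝ := fun i => (hdf2 i).1.mk (df i) with hdf'
  have hdd' : ∀ i, df i =ᵐ[uniformProd] df' i := fun i => (hdf2 i).1.ae_eq_mk
  have hdm : ∀ i, Measurable (df' i) := fun i => (hdf2 i).1.stronglyMeasurable_mk.measurable
  have hd2 : ∀ i, MemLp (df' i) 2 uniformProd := fun i => (memLp_congr_ae (hdd' i)).1 (hdf2 i)
  have hS' : ∀ i, eLpNorm (coordDelta i f) 1 uniformProd ^ 2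
      = ENNReal.ofReal ((∫ x, |coordDelta i f' x| ∂uniformProd) ^ 2) := fun i => by
    have h1 := integrable_coordDelta (hf2.integrable (by norm_num)) i
    rw [eLpNorm_congr_ae (coordDelta_congr_ae hff' i), eLpNorm_one_eq_lintegral_enorm,
      ← ofReal_integral_norm_eq_lintegral_enorm h1,
      ENNReal.ofReal_pow (integral_nonneg fun x => abs_nonneg _)]
    rfl
  have hD' : ∀ i, ∫⁻ x, ENNReal.ofReal (df i x ^ 2) ∂uniformProd
      = ENNReal.ofReal (∫ x, df' i x ^ 2 ∂uniformProd) := fun i => by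
    rw [ofReal_integral_eq_lintegral_ofReal (hd2 i).integrable_sq
      (Filter.Eventually.of_forall fun x => sq_nonneg _)]
    exact lintegral_congr_ae ((hdd' i).mono fun x hx => by simp only [hx])
  have hmain : ∀ θ : ℝ, 0 < θ → variance f' uniformProd * Real.log θ + variance f' uniformProd
      - θ * S.toReal ≤ 2 / Real.pi ^ 2 * D.toReal := fun θ hθ =>
    variance_logSobolev hfm hf2 hdm hd2 (fun i => (hdf i).isTestPartialDeriv hff' (hdd' i))
      (sum_le_toReal_tsum hS' (fun i => sq_nonneg _) hStop)
      (sum_le_toReal_tsum hD' (fun i => integral_nonneg fun x => sq_nonneg _) hDtop) hθ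
  have hVA : evariance f uniformProd = ENNReal.ofReal (variance f' uniformProd) := by
    rw [hf2.ofReal_variance_eq, evariance_congr hff']
  set A := variance f' uniformProd with hA
  have hA0 : 0 < A := by
    rw [hVA] at hV0
    simpa using hV0
  have hS0 : 0 < S.toReal := by
    rcases (ENNReal.toReal_nonneg (a := S)).eq_or_lt with h | h
    · exfalso
      -- If the sum of squared `L¹` norms vanished, the linearised inequality would fail for large
      -- `θ`: with this `θ` it reads `R + A ≤ R`, where `R` is its right-hand side.
      have h1 := hmain (Real.exp (2 / Real.pi ^ 2 * D.toReal / A)) (Real.exp_pos _)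
      rw [← h, Real.log_exp, mul_div_cancel₀ _ hA0.ne'] at h1
      linarith
    · exact h
  -- The optimal `θ`, for which the terms `A` and `-θ S` cancel.
  have hfin := hmain (A / S.toReal) (by positivity)
  rw [div_mul_cancel₀ _ hS0.ne'] at hfin
  have hfin2 : A * Real.log (A / S.toReal) ≤ 2 / Real.pi ^ 2 * D.toReal := by linarith
  rw [hVA, ← ENNReal.ofReal_toReal hStop, ← ENNReal.ofReal_toReal hDtop,
    ← ENNReal.ofReal_div_of_pos hS0, ENNReal.log_ofReal_of_pos (by positivity),
    ← ENNReal.ofReal_mul hK.le, EReal.coe_ennreal_ofReal, EReal.coe_ennreal_ofReal,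
    max_eq_left hA0.le, max_eq_left (mul_nonneg hK.le ENNReal.toReal_nonneg), ← EReal.coe_mul,
    EReal.coe_le_coe_iff]
  exact hfin2
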